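/- Let $M$ be a smooth (Hausdorff, finite-dimensional, real, boundaryless) manifold and equip $TM$ with its standard Lie algebroid structure (Lie bracket of vector fields, anchor the identity). For $m\in M$ let $\mathfrak{D}(TM)_m$ be the space of $\mathbb{R}$-linear operators $\mathfrak{d}:\Gamma(TM)\to T_mM$ together with a tangent vector $x=\alpha(\mathfrak{d})\in T_mM$ (the anchor) such that $\mathfrak{d}(fu)=f(m)\,\mathfrak{d}(u)+x(f)\,u(m)$ for all $f\in C^\infty(M)$, $u\in\Gamma(TM)$. The gauge algebroid $\mathfrak{D}(TM)$ has anchor $\alpha$ and the commutator of operators as bracket; $\mathbf{i}:\mathfrak{gl}(TM)\to\mathfrak{D}(TM)$ is the inclusion $\Phi\mapsto(u\mapsto\Phi(u(m)))$. Let $\mathfrak{J}(TM)$ be the first jet bundle of $TM$, with fibre $\{[u]_m: u\in\Gamma(TM)\}$, projection $\mathbf{p}([u]_m)=u(m)$, prolongation $\mathbf{d}u=(m\mapsto[u]_m)$, $TM$-valued pairing $\langle[u]_m,\mathfrak{d}\rangle=\mathfrak{d}(u)$ with $\mathfrak{D}(TM)$, and inclusion $\mathbf{e}:\mathfrak{gl}(TM)=\mathrm{Hom}(TM,TM)\to\mathfrak{J}(TM)$,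 $\langle\mathbf{e}(y),\mathfrak{d}\rangle=y(\alpha(\mathfrak{d}))$. Put $\pi([u]_m)=[u,\cdot\,](m)$ and $\langle\mathfrak{L}_{\mathfrak{d}}\mu,\mathfrak{d}'\rangle=\mathfrak{d}\langle\mu,\mathfrak{d}'\rangle-\langle\mu,[\mathfrak{d},\mathfrak{d}']\rangle$, and equip $\mathfrak{J}(TM)$ with the anchor $\alpha\circ\pi$ and the bracket $$[\mu,\nu]=\mathfrak{L}_{\pi(\mu)}\nu-\mathfrak{L}_{\pi(\nu)}\mu-\mathbf{d}\langle\pi(\mu),\nu\rangle ,\qquad \mu,\nu\in\Gamma(\mathfrak{J}(TM)).$$ Then $TM$, $\mathfrak{gl}(TM)$ (commutator bracket, zero anchor), $\mathfrak{gl}(TM)^{op}$ (opposite bracket, zero anchor), $\mathfrak{D}(TM)$ and $\mathfrak{J}(TM)$ are Lie algebroids over $M$; the jet sequence and the Atiyah sequence $$0\to\mathfrak{gl}(TM)^{op}\xrightarrow{\ \mathbf{e}\ }\mathfrak{J}(TM)\xrightarrow{\ \mathbf{p}\ }TM\to0,\qquad 0\to\mathfrak{gl}(TM)\xrightarrow{\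 \mathbf{i}\ }\mathfrak{D}(TM)\xrightarrow{\ \alpha\ }TM\to0$$ are exact sequences of Lie algebroid morphisms; and there is a Lie algebroid isomorphism $\hat{\mathbf{i}}_{TM}:\mathfrak{J}(TM)\to\mathfrak{D}(TM)$ over the identity of $M$, given canonically by $\hat{\mathbf{i}}_{TM}([u]_m)=[u,\cdot\,](m)$ (with anchor $u(m)$), such that $$\hat{\mathbf{i}}_{TM}\circ\mathbf{e}=\mathbf{i}\circ(-\mathbf{1}_{\mathfrak{gl}(TM)}),\qquad \alpha\circ\hat{\mathbf{i}}_{TM}=\mathbf{1}_{TM}\circ\mathbf{p}.$$ -/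

import Mathlib

open Bundle VectorField
open scoped Manifold ContDiff Topology

noncomputable section

namespace JetGauge

section Basics

variable (E : Type*) [NormedAddCommGroup E] [NormedSpace ℝ E]
  {M : Type*} [TopologicalSpace M] [ChartedSpace E M]

/-- The tangent space `T_m M`. -/
abbrev Tang (m : M) : Type _ := TangentSpace 𝓘(ℝ, E) m

variable (M)

/-- Smooth real-valued functions on `M`. -/
abbrev SmoothFn : Type _ := C^∞⟮𝓘(ℝ, E), M; ℝ⟯

variable [IsManifold 𝓘(ℝ, E) ∞ M]

instance : IsManifold 𝓘(ℝ, E) (minSmoothness ℝ 3) M :=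
  IsManifold.of_le (n := ∞) (by
    rw [minSmoothness_of_isRCLikeNormedField]; exact ENat.LEInfty.out)

/-- `Γ(TM)`: smooth vector fields on `M`. -/
abbrev VField : Type _ := Cₛ^∞⟮𝓘(ℝ, E); E, (fun m : M => Tang E m)⟯

instance : AddCommGroup (VField E M) := inferInstance
instance : AddCommMonoid (VField E M) := inferInstance
instance : AddGroup (VField E M) := inferInstance
instance : AddMonoid (VField E M) := inferInstance
instance : AddZeroClass (VField E M) := inferInstance
instance : Module ℝ (VField E M) := inferInstance

/-- `Γ(T*M)`: smooth one-forms on `M`. -/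
abbrev OneForm : Type _ :=
  Cₛ^∞⟮𝓘(ℝ, E); E →L[ℝ] ℝ, (fun m : M => Tang E m →L[ℝ] Bundle.Trivial M ℝ m)⟯

variable {M} {E}

/-- The product `f u` of a smooth function and a smooth vector field. -/
def fsmul (f : SmoothFn E M) (u : VField E M) : VField E M :=
  ⟨fun m => f m • u m, f.contMDiff.smul_section u.contMDiff⟩

@[simp] lemma fsmul_apply (f : SmoothFn E M) (u : VField E M) (m : M) :
    fsmul f u m = f m • u m := rfl

/-- The Lie bracket of smooth vector fields. -/
def vbracket [FiniteDimensional ℝ E] (u v : VField E M) : VField E M :=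
  ⟨fun m => mlieBracket 𝓘(ℝ, E) u v m, by
    have : IsManifold 𝓘(ℝ, E) (((⊤ : ℕ∞) : WithTop ℕ∞) + 1) M := ‹IsManifold 𝓘(ℝ, E) ∞ M›
    have := FiniteDimensional.complete ℝ E
    have := ContDiff.mlieBracket_vectorField (𝕜 := ℝ) (I := 𝓘(ℝ, E)) (m := ⊤) (n := ⊤)
      u.contMDiff v.contMDiff (by simp [minSmoothness_of_isRCLikeNormedField])
    exact this⟩

lemma vbracket_apply [FiniteDimensional ℝ E] (u v : VField E M) (m : M) :
    vbracket u v m = mlieBracket 𝓘(ℝ, E) u v m := rfl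

/-- The derivative `X(f)` of a smooth function along a smooth vector field. -/
def dir (X : VField E M) (f : SmoothFn E M) : SmoothFn E M :=
  ⟨fun m => mvfderiv 𝓘(ℝ, E) f m (X m), by
    have h1 : ContMDiff 𝓘(ℝ, E).tangent 𝓘(ℝ, ℝ).tangent ∞ (tangentMap 𝓘(ℝ, E) 𝓘(ℝ, ℝ) f) :=
      f.contMDiff.contMDiff_tangentMap (by simp)
    exact (contMDiff_snd_tangentBundle_modelSpace ℝ 𝓘(ℝ, ℝ)).comp (h1.comp X.contMDiff)⟩

lemma dir_apply (X : VField E M) (f : SmoothFn E M) (m : M) :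
    dir X f m = mvfderiv 𝓘(ℝ, E) f m (X m) := rfl


/-- The contraction of a one-form with a vector field. -/
def contract (ξ : OneForm E M) (u : VField E M) : SmoothFn E M :=
  ⟨fun m => ξ m (u m), by
    have h := ContMDiff.clm_bundle_apply (IB := 𝓘(ℝ, E)) (F₂ := ℝ) ξ.contMDiff u.contMDiff
    intro m
    exact ((contMDiffAt_section m).1 (h m))⟩

lemma contract_apply (ξ : OneForm E M) (u : VField E M) (m : M) : contract ξ u m = ξ m (u m) := rfl

section Calculus

@[simp] lemma dir_fsmul (f : SmoothFn E M) (X : VField E M) (g : SmoothFn E M) (m : M) :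
    dir (fsmul f X) g m = f m * dir X g m := by
  simp [dir_apply]

lemma mdiff_fn (f : SmoothFn E M) (m : M) : MDifferentiableAt 𝓘(ℝ, E) 𝓘(ℝ, ℝ) f m :=
  f.contMDiff.mdifferentiableAt (by simp)

lemma mdiff_field (u : VField E M) (m : M) :
    MDifferentiableAt 𝓘(ℝ, E) 𝓘(ℝ, E).tangent (fun p => (⟨p, u p⟩ : TangentBundle 𝓘(ℝ, E) M)) m :=
  u.contMDiff.mdifferentiableAt (by simp)

variable [FiniteDimensional ℝ E]

lemma vbracket_fsmul_right (u v : VField E M) (f : SmoothFn E M) :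
    vbracket u (fsmul f v) = fsmul f (vbracket u v) + fsmul (dir u f) v := by
  have := FiniteDimensional.complete ℝ E
  ext m
  have := mlieBracket_smul_right (I := 𝓘(ℝ, E)) (V := u) (mdiff_fn f m) (mdiff_field v m)
  exact this.trans (add_comm _ _)

lemma vbracket_swap (u v : VField E M) : vbracket u v = - vbracket v u := by
  ext m
  exact mlieBracket_swap_apply

lemma vbracket_add_right (u v w : VField E M) :
    vbracket u (v + w) = vbracket u v + vbracket u w := by
  have := FiniteDimensional.complete ℝ E
  ext m
  exact mlieBracket_add_right (V := u) (mdiff_field v m) (mdiff_field w m)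

lemma vbracket_smul_right (u : VField E M) (c : ℝ) (v : VField E M) :
    vbracket u (c • v) = c • vbracket u v := by
  have := FiniteDimensional.complete ℝ E
  ext m
  exact mlieBracket_const_smul_right (V := u) (mdiff_field v m)

lemma vbracket_add_left (u v w : VField E M) :
    vbracket (u + v) w = vbracket u w + vbracket v w := by
  rw [vbracket_swap, vbracket_add_right, vbracket_swap w u, vbracket_swap w v]; abel

lemma vbracket_smul_left (c : ℝ) (u v : VField E M) :
    vbracket (c • u) v = c • vbracket u v := by
  rw [vbracket_swap, vbracket_smul_right, vbracket_swap v u, smul_neg, neg_neg]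

lemma vbracket_fsmul_left (u v : VField E M) (f : SmoothFn E M) :
    vbracket (fsmul f u) v = fsmul f (vbracket u v) - fsmul (dir v f) u := by
  rw [vbracket_swap, vbracket_fsmul_right, vbracket_swap v u]
  ext m; simp; abel

lemma vbracket_jacobi (u v w : VField E M) :
    vbracket u (vbracket v w) = vbracket (vbracket u v) w + vbracket v (vbracket u w) := by
  have := FiniteDimensional.complete ℝ E
  ext m
  have h2 : ∀ (x : VField E M), ContMDiffAt 𝓘(ℝ, E) 𝓘(ℝ, E).tangent (minSmoothness ℝ 2)
      (fun p => (⟨p, x p⟩ : TangentBundle 𝓘(ℝ, E) M)) m := fun x =>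
    (x.contMDiff m).of_le (by
      rw [minSmoothness_of_isRCLikeNormedField]; exact ENat.LEInfty.out)
  exact leibniz_identity_mlieBracket_apply (h2 u) (h2 v) (h2 w)

/-- The identity `[X, Y](f) = X(Y(f)) - Y(X(f))`, multiplied by an arbitrary vector field. -/
lemma dir_vbracket_smul (X Y Z : VField E M) (f : SmoothFn E M) (m : M) :
    dir (vbracket X Y) f m • Z m = (dir X (dir Y f) m - dir Y (dir X f) m) • Z m := by
  have h := congrArg (fun s : VField E M => s m) (vbracket_jacobi X Y (fsmul f Z))
  simp only [vbracket_fsmul_right, vbracket_add_right, ContMDiffSection.coe_add, Pi.add_apply,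
    fsmul_apply] at h
  have h' := congrArg (fun s : VField E M => s m) (vbracket_jacobi X Y Z)
  simp only [ContMDiffSection.coe_add, Pi.add_apply] at h'
  rw [h'] at h
  rw [sub_smul]
  rw [smul_add] at h
  rw [← sub_eq_zero] at h ⊢
  rw [← neg_eq_zero, ← h]
  module

end Calculus

/-! ### The gauge algebroid of `TM` -/

section Gauge

/-- The fibre at `m` of the gauge algebroid of `TM`: pairs of an `ℝ`-linear operator
`d : Γ(TM) → T_m M` and a tangent vector `x`, the anchor, with `d(f u) = f(m) d(u) + x(f) u(m)`. -/
def gaugeFiber (m : M) : Submodule ℝ ((VField E M →ₗ[ℝ] Tang E m) × Tang E m) where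
  carrier := {d | ∀ (f : SmoothFn E M) (u : VField E M),
    d.1 (fsmul f u) = f m • d.1 u + mvfderiv 𝓘(ℝ, E) f m d.2 • u m}
  add_mem' := by
    intro a b ha hb f u
    simp only [Prod.fst_add, LinearMap.add_apply, ha f u, hb f u, Prod.snd_add, map_add, smul_add,
      add_smul]
    abel
  zero_mem' := by intro f u; simp
  smul_mem' := by
    intro c a ha f u
    simp only [Prod.smul_fst, LinearMap.smul_apply, ha f u, Prod.smul_snd, map_smul, smul_add,
      smul_smul, smul_eq_mul, mul_comm c]

variable (E) in
/-- The fibre `𝔇(TM)_m`. -/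
abbrev Gauge (m : M) : Type _ := ↥(gaugeFiber (E := E) m)

instance (m : M) : AddCommGroup (Gauge E m) := inferInstance
instance (m : M) : AddCommMonoid (Gauge E m) := inferInstance
instance (m : M) : AddGroup (Gauge E m) := inferInstance
instance (m : M) : AddMonoid (Gauge E m) := inferInstance
instance (m : M) : AddZeroClass (Gauge E m) := inferInstance
instance (m : M) : Module ℝ (Gauge E m) := inferInstance

/-- The operator `Γ(TM) → T_m M` underlying an element of `𝔇(TM)_m`. -/
def gaugeOp (m : M) : Gauge E m →ₗ[ℝ] (VField E M →ₗ[ℝ] Tang E m) :=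
  (LinearMap.fst ℝ _ _).comp (gaugeFiber m).subtype

/-- The anchor `α : 𝔇(TM)_m → T_m M`. -/
def gaugeAnchor (m : M) : Gauge E m →ₗ[ℝ] Tang E m :=
  (LinearMap.snd ℝ _ _).comp (gaugeFiber m).subtype

lemma gaugeOp_fsmul {m : M} (d : Gauge E m) (f : SmoothFn E M) (u : VField E M) :
    gaugeOp m d (fsmul f u) = f m • gaugeOp m d u
      + mvfderiv 𝓘(ℝ, E) f m (gaugeAnchor m d) • u m := d.2 f u

lemma gauge_ext {m : M} {d d' : Gauge E m} (h : ∀ u, gaugeOp m d u = gaugeOp m d' u)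
    (h' : gaugeAnchor m d = gaugeAnchor m d') : d = d' :=
  Subtype.ext (Prod.ext (LinearMap.ext h) h')

/-- The inclusion `𝕚 : 𝔤𝔩(T_m M) → 𝔇(TM)_m`, sending `Φ` to `u ↦ Φ(u(m))`, with anchor zero. -/
def gaugeEmbed (m : M) : (Tang E m →L[ℝ] Tang E m) →ₗ[ℝ] Gauge E m where
  toFun Φ := ⟨({ toFun := fun u => Φ (u m)
                 map_add' := by intro u v; simp
                 map_smul' := by intro c u; simp }, 0), by intro f u; simp⟩
  map_add' := by
    intro a b
    apply Subtype.ext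
    refine Prod.ext ?_ ?_
    · ext u; rfl
    · simp
  map_smul' := by
    intro c a
    apply Subtype.ext
    refine Prod.ext ?_ ?_
    · ext u; rfl
    · simp

/-- `Γ(𝔇(TM))`: a section is smooth when it carries smooth vector fields to smooth vector fields
and its anchor is a smooth vector field. -/
def gaugeSections : Submodule ℝ (∀ m : M, Gauge E m) where
  carrier := {d | (∀ u : VField E M, ContMDiff 𝓘(ℝ, E) 𝓘(ℝ, E).tangent ∞
      (fun m => (⟨m, gaugeOp m (d m) u⟩ : TangentBundle 𝓘(ℝ, E) M))) ∧
    ContMDiff 𝓘(ℝ, E) 𝓘(ℝ, E).tangent ∞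
      (fun m => (⟨m, gaugeAnchor m (d m)⟩ : TangentBundle 𝓘(ℝ, E) M))}
  add_mem' := by
    intro a b ha hb
    refine ⟨fun u => ?_, ?_⟩
    · simpa using! (ha.1 u).add_section (hb.1 u)
    · simpa using! ha.2.add_section hb.2
  zero_mem' := by
    refine ⟨fun u => ?_, ?_⟩
    · simpa using! (0 : VField E M).contMDiff
    · simpa using! (0 : VField E M).contMDiff
  smul_mem' := by
    intro c a ha
    refine ⟨fun u => ?_, ?_⟩
    · simpa using! (ha.1 u).const_smul_section (a := c)
    · simpa using! ha.2.const_smul_section (a := c)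

variable (E M) in
/-- The type `Γ(𝔇(TM))`. -/
abbrev GaugeSec : Type _ := ↥(gaugeSections (E := E) (M := M))

instance : AddCommGroup (GaugeSec E M) := inferInstance
instance : AddCommMonoid (GaugeSec E M) := inferInstance
instance : AddGroup (GaugeSec E M) := inferInstance
instance : AddMonoid (GaugeSec E M) := inferInstance
instance : AddZeroClass (GaugeSec E M) := inferInstance
instance : Module ℝ (GaugeSec E M) := inferInstance

/-- The action of a smooth section of `𝔇(TM)` on a smooth vector field. -/
def gact (d : GaugeSec E M) (u : VField E M) : VField E M :=
  ⟨fun m => gaugeOp m (d.1 m) u, d.2.1 u⟩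

/-- The anchor of a smooth section of `𝔇(TM)`, as a smooth vector field. -/
def ganchor (d : GaugeSec E M) : VField E M := ⟨fun m => gaugeAnchor m (d.1 m), d.2.2⟩

lemma gact_apply (d : GaugeSec E M) (u : VField E M) (m : M) :
    gact d u m = gaugeOp m (d.1 m) u := rfl

lemma ganchor_apply (d : GaugeSec E M) (m : M) : ganchor d m = gaugeAnchor m (d.1 m) := rfl

lemma gact_fsmul (d : GaugeSec E M) (f : SmoothFn E M) (u : VField E M) :
    gact d (fsmul f u) = fsmul f (gact d u) + fsmul (dir (ganchor d) f) u := by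
  ext m
  exact gaugeOp_fsmul _ _ _

variable [FiniteDimensional ℝ E]

/-- The bracket of `Γ(𝔇(TM))`: the commutator of operators. -/
def gaugeBracket (d d' : GaugeSec E M) : GaugeSec E M :=
  ⟨fun m => ⟨({ toFun := fun u => gaugeOp m (d.1 m) (gact d' u) - gaugeOp m (d'.1 m) (gact d u)
                map_add' := by
                  intro u v
                  have h : ∀ e : GaugeSec E M, gact e (u + v) = gact e u + gact e v := by
                    intro e; ext p; simp [gact_apply]
                  simp only [h, map_add]; abel
                map_smul' := by
                  intro c u
                  have h : ∀ e : GaugeSec E M, gact e (c • u) = c • gact e u := by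
                    intro e; ext p; simp [gact_apply]
                  simp only [h, map_smul, RingHom.id_apply, smul_sub] },
              vbracket (ganchor d) (ganchor d') m), by
      intro f u
      have key := dir_vbracket_smul (ganchor d) (ganchor d') u f m
      rw [dir_apply] at key
      simp only [LinearMap.coe_mk, AddHom.coe_mk]
      rw [key, gact_fsmul, gact_fsmul, map_add, map_add]
      simp only [gaugeOp_fsmul, gact_apply]
      simp only [← ganchor_apply, ← dir_apply, smul_sub, sub_smul]
      abel⟩, by
    refine ⟨fun u => ?_, (vbracket (ganchor d) (ganchor d')).contMDiff⟩
    exact (gact d (gact d' u) - gact d' (gact d u)).contMDiff⟩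

lemma gact_gaugeBracket (d d' : GaugeSec E M) (u : VField E M) :
    gact (gaugeBracket d d') u = gact d (gact d' u) - gact d' (gact d u) := rfl

lemma ganchor_gaugeBracket (d d' : GaugeSec E M) :
    ganchor (gaugeBracket d d') = vbracket (ganchor d) (ganchor d') := rfl

/-- The element `[u, ·](m)` of `𝔇(TM)_m`, with anchor `u(m)`, linearly in `u`. -/
def adAt (m : M) : VField E M →ₗ[ℝ] Gauge E m where
  toFun u := ⟨({ toFun := fun v => vbracket u v m
                 map_add' := by intro v w; rw [vbracket_add_right]; rfl
                 map_smul' := by intro c v; rw [vbracket_smul_right]; rfl }, u m), by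
      intro f v
      simp only [LinearMap.coe_mk, AddHom.coe_mk, vbracket_fsmul_right]
      rfl⟩
  map_add' := by
    intro u v
    refine gauge_ext (fun w => ?_) rfl
    exact congrArg (fun s : VField E M => s m) (vbracket_add_left u v w)
  map_smul' := by
    intro c v
    refine gauge_ext (fun w => ?_) rfl
    exact congrArg (fun s : VField E M => s m) (vbracket_smul_left c v w)

lemma gaugeOp_adAt (m : M) (u v : VField E M) : gaugeOp m (adAt m u) v = vbracket u v m := rfl

lemma gaugeAnchor_adAt (m : M) (u : VField E M) : gaugeAnchor m (adAt m u) = u m := rfl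

/-- The derivation `[u, ·]` of `TM`, as a smooth section of `𝔇(TM)`. -/
def ad (u : VField E M) : GaugeSec E M :=
  ⟨fun m => adAt m u, fun v => (vbracket u v).contMDiff, u.contMDiff⟩

lemma ad_apply (u : VField E M) (m : M) : (ad u).1 m = adAt m u := rfl

end Gauge

end Basics


section Frames

variable {E : Type*} [NormedAddCommGroup E] [NormedSpace ℝ E] [FiniteDimensional ℝ E]
  {M : Type*} [TopologicalSpace M] [ChartedSpace E M] [IsManifold 𝓘(ℝ, E) ∞ M] [T2Space M]

variable (E) in
/-- A smooth bump function at `m`, equal to `1` near `m` and supported in the preferred chart. -/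
def bump (m : M) : SmoothBumpFunction 𝓘(ℝ, E) m := Classical.arbitrary _

variable (E) in
/-- The bump function at `m` as a smooth function on `M`. -/
def bumpFn (m : M) : SmoothFn E M := ⟨bump E m, (bump E m).contMDiff⟩

@[simp] lemma bumpFn_self (m : M) : bumpFn E m m = 1 := (bump E m).eq_one

variable (E) in
/-- The trivialization of `TM` over the preferred chart at `m`. -/
abbrev triv (m : M) : Trivialization E (TotalSpace.proj : TangentBundle 𝓘(ℝ, E) M → M) :=
  trivializationAt E (fun p : M => Tang E p) m

lemma tsupport_bump (m : M) : tsupport (bump E m) ⊆ (triv E m).baseSet := by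
  rw [TangentBundle.trivializationAt_baseSet]
  exact (bump E m).tsupport_subset_chartAt_source

lemma bumpFn_eq_zero {m p : M} (hp : p ∉ (triv E m).baseSet) : bumpFn E m p = 0 :=
  image_eq_zero_of_notMem_tsupport fun h => hp (tsupport_bump m h)

/-- The vector field which near `m` is the `i`-th coordinate vector field of the preferred chart
at `m` (with respect to a basis of `E`), cut off outside of that chart. -/
def frame (m : M) (i : Fin (Module.finrank ℝ E)) : VField E M :=
  ⟨(bump E m : M → ℝ) • fun p => (triv E m).symm p (Module.finBasis ℝ E i), by
    refine ContMDiffOn.smul_section_of_tsupport (bump E m).contMDiff.contMDiffOn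
      (triv E m).open_baseSet (tsupport_bump m) ?_
    rw [(triv E m).contMDiffOn_section_baseSet_iff]
    refine (contMDiffOn_const (c := Module.finBasis ℝ E i)).congr ?_
    intro y hy
    rw [Trivialization.apply_mk_symm _ hy]⟩

lemma frame_apply (m p : M) (i : Fin (Module.finrank ℝ E)) :
    frame m i p = bumpFn E m p • (triv E m).symm p (Module.finBasis ℝ E i) := rfl

variable (E) in
/-- The coordinate basis of `T_m M` in the preferred chart at `m`. -/
def tbasis (m : M) : Module.Basis (Fin (Module.finrank ℝ E)) ℝ (Tang E m) := Module.finBasis ℝ E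

@[simp] lemma frame_self (m : M) (i : Fin (Module.finrank ℝ E)) :
    frame m i m = tbasis E m i := by
  rw [frame_apply, bumpFn_self, one_smul]
  have h := TangentBundle.symmL_trivializationAt (I := 𝓘(ℝ, E)) (𝕜 := ℝ) (mem_chart_source E m)
  rw [mfderivWithin_range_extChartAt_symm] at h
  refine ((triv E m).symmL_apply (R := ℝ) (mem_baseSet_trivializationAt E _ m) _).symm.trans ?_
  exact congrArg (fun L : E →L[ℝ] Tang E m => L (Module.finBasis ℝ E i)) h

/-- The coordinate covectors dual to `frame`, cut off outside of the preferred chart at `m`. -/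
def coframe (m : M) (i : Fin (Module.finrank ℝ E)) : OneForm E M :=
  ⟨(bump E m : M → ℝ) • fun p => ((Module.finBasis ℝ E).coord i).toContinuousLinearMap ∘L
      (triv E m).continuousLinearMapAt ℝ p, by
    refine ContMDiffOn.smul_section_of_tsupport (bump E m).contMDiff.contMDiffOn
      (triv E m).open_baseSet (tsupport_bump m) ?_
    intro x hx
    refine ContMDiffAt.contMDiffWithinAt ?_
    rw [contMDiffAt_hom_bundle]
    refine ⟨contMDiffAt_id, ?_⟩
    have hx' : x ∈ (triv E x).baseSet := mem_baseSet_trivializationAt E _ x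
    have hc := contMDiffAt_coordChangeL (IB := 𝓘(ℝ, E)) (n := ∞) (e := triv E x) (e' := triv E m)
      hx' hx
    have h2 : ContMDiffAt 𝓘(ℝ, E) 𝓘(ℝ, E →L[ℝ] ℝ) ∞ (fun p =>
        ((Module.finBasis ℝ E).coord i).toContinuousLinearMap ∘L
        ((triv E x).coordChangeL ℝ (triv E m) p : E →L[ℝ] E)) x :=
      contMDiffAt_const.clm_comp hc
    refine h2.congr_of_eventuallyEq ?_
    filter_upwards [(triv E x).open_baseSet.mem_nhds hx', (triv E m).open_baseSet.mem_nhds hx]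
      with p hp hp'
    ext v
    simp [ContinuousLinearMap.inCoordinates, Trivialization.coordChangeL_apply' _ _ ⟨hp, hp'⟩,
      Trivialization.coe_linearMapAt_of_mem _ hp', (triv E x).symmL_apply hp,
      (triv E x).mk_symm hp]⟩

lemma coframe_apply (m p : M) (i : Fin (Module.finrank ℝ E)) (v : Tang E p) :
    coframe m i p v = bumpFn E m p *
      (Module.finBasis ℝ E).repr ((triv E m).continuousLinearMapAt ℝ p v) i := rfl

lemma sum_coframe (m p : M) (v : Tang E p) :
    ∑ i, coframe m i p v • frame m i p = (bumpFn E m p * bumpFn E m p) • v := by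
  by_cases hp : p ∈ (triv E m).baseSet
  · simp only [coframe_apply, frame_apply, smul_smul]
    have h1 : ∀ i, (triv E m).symm p (Module.finBasis ℝ E i)
        = (triv E m).symmL ℝ p (Module.finBasis ℝ E i) := fun i => ((triv E m).symmL_apply hp _).symm
    calc _ = ∑ i, (bumpFn E m p * bumpFn E m p) • (triv E m).symmL ℝ p
          (((Module.finBasis ℝ E).repr ((triv E m).continuousLinearMapAt ℝ p v) i) •
            Module.finBasis ℝ E i) := by
          refine Finset.sum_congr rfl fun i _ => ?_
          rw [h1, map_smul, smul_smul]
          congr 1; ring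
      _ = _ := by
          rw [← Finset.smul_sum, ← map_sum, Module.Basis.sum_repr,
            Trivialization.symmL_continuousLinearMapAt _ hp]
  · simp [frame_apply, bumpFn_eq_zero hp]


/-- The `i`-th coordinate of the preferred chart at `m`, vanishing at `m` and cut off outside of
the chart. -/
def coordFn (m : M) (i : Fin (Module.finrank ℝ E)) : SmoothFn E M :=
  ⟨fun p => bump E m p • ((Module.finBasis ℝ E).coord i).toContinuousLinearMap
      (extChartAt 𝓘(ℝ, E) m p - extChartAt 𝓘(ℝ, E) m m), by
    refine (bump E m).contMDiff_smul ?_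
    refine ContMDiffOn.clm_apply contMDiffOn_const ?_
    exact (contMDiffOn_extChartAt (I := 𝓘(ℝ, E)) (n := ∞)).sub contMDiffOn_const⟩

@[simp] lemma coordFn_self (m : M) (i : Fin (Module.finrank ℝ E)) : coordFn (E := E) m i m = 0 := by
  simp [coordFn]

lemma mvfderiv_coordFn (m : M) (i : Fin (Module.finrank ℝ E)) (v : Tang E m) :
    mvfderiv 𝓘(ℝ, E) (coordFn (E := E) m i) m v = (tbasis E m).repr v i := by
  set L : E →L[ℝ] ℝ := ((Module.finBasis ℝ E).coord i).toContinuousLinearMap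
  have h1 : HasMFDerivAt 𝓘(ℝ, E) 𝓘(ℝ, E) (extChartAt 𝓘(ℝ, E) m) m
      (ContinuousLinearMap.id ℝ (Tang E m)) := by
    have := (mdifferentiableAt_extChartAt (I := 𝓘(ℝ, E)) (mem_chart_source E m)).hasMFDerivAt
    rwa [mfderiv_extChartAt_self] at this
  have h2 : HasMFDerivAt 𝓘(ℝ, E) 𝓘(ℝ, ℝ)
      (fun p => L (extChartAt 𝓘(ℝ, E) m p - extChartAt 𝓘(ℝ, E) m m)) m L := by
    have hL : HasMFDerivAt 𝓘(ℝ, E) 𝓘(ℝ, ℝ)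
        (fun x : E => L (x - extChartAt 𝓘(ℝ, E) m m)) (extChartAt 𝓘(ℝ, E) m m) L := by
      apply HasFDerivAt.hasMFDerivAt
      exact L.hasFDerivAt.comp _ ((hasFDerivAt_id _).sub_const _)
    exact hL.comp m h1
  have h3 : HasMFDerivAt 𝓘(ℝ, E) 𝓘(ℝ, ℝ) (coordFn (E := E) m i) m L := by
    refine h2.congr_of_eventuallyEq ?_
    filter_upwards [(bump E m).eventuallyEq_one] with p hp
    change bump E m p • L (extChartAt 𝓘(ℝ, E) m p - extChartAt 𝓘(ℝ, E) m m) = _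
    rw [hp]; exact one_smul ℝ _
  rw [mvfderiv, h3.mfderiv]
  rfl

end Frames

section Jets

variable {E : Type*} [NormedAddCommGroup E] [NormedSpace ℝ E]
  {M : Type*} [TopologicalSpace M] [ChartedSpace E M] [IsManifold 𝓘(ℝ, E) ∞ M]

lemma contract_add (ξ : OneForm E M) (u v : VField E M) :
    contract ξ (u + v) = contract ξ u + contract ξ v := by
  ext m; simp [contract_apply]

lemma contract_smul (ξ : OneForm E M) (c : ℝ) (u : VField E M) :
    contract ξ (c • u) = c • contract ξ u := by
  ext m; simp [contract_apply]

lemma mvfderiv_fn_add (f g : SmoothFn E M) (m : M) :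
    mvfderiv 𝓘(ℝ, E) (f + g : SmoothFn E M) m
      = mvfderiv 𝓘(ℝ, E) f m + mvfderiv 𝓘(ℝ, E) g m :=
  mvfderiv_add (mdiff_fn f m) (mdiff_fn g m)

lemma mvfderiv_fn_smul (c : ℝ) (f : SmoothFn E M) (m : M) :
    mvfderiv 𝓘(ℝ, E) (c • f : SmoothFn E M) m = c • mvfderiv 𝓘(ℝ, E) f m := by
  have h := mvfderiv_smul (I := 𝓘(ℝ, E)) (mdifferentiableAt_const (c := c)) (mdiff_fn f m)
  ext v
  have h' := congrArg (fun L : Tang E m →L[ℝ] ℝ => L v) h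
  simpa [mvfderiv_const] using! h'

/-- The vector fields `u` with `u(m) = 0` and `d⟨u, ξ⟩_m = 0` for every one-form `ξ`. -/
def jetNull (m : M) : Submodule ℝ (VField E M) where
  carrier := {u | u m = 0 ∧ ∀ ξ : OneForm E M, mvfderiv 𝓘(ℝ, E) (contract ξ u) m = 0}
  add_mem' := by
    rintro u v ⟨hu, hu'⟩ ⟨hv, hv'⟩
    refine ⟨by simp [hu, hv], fun ξ => ?_⟩
    rw [contract_add, mvfderiv_fn_add, hu', hv', add_zero]
  zero_mem' := by
    refine ⟨rfl, fun ξ => ?_⟩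
    have : contract ξ (0 : VField E M) = (0 : ℝ) • contract ξ 0 := by
      rw [← contract_smul, zero_smul]
    rw [this, mvfderiv_fn_smul, zero_smul]
  smul_mem' := by
    rintro c u ⟨hu, hu'⟩
    refine ⟨by simp [hu], fun ξ => ?_⟩
    rw [contract_smul, mvfderiv_fn_smul, hu', smul_zero]

variable (E) in
/-- The fibre `𝔍(TM)_m` of the first jet bundle of `TM`: smooth vector fields modulo the relation
of having the same value at `m` and the same `d⟨·, ξ⟩_m` for every one-form `ξ`. -/
abbrev Jet (m : M) : Type _ := VField E M ⧸ jetNull (E := E) m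

instance (m : M) : AddCommGroup (Jet E m) := inferInstance
instance (m : M) : AddCommMonoid (Jet E m) := inferInstance
instance (m : M) : AddGroup (Jet E m) := inferInstance
instance (m : M) : AddMonoid (Jet E m) := inferInstance
instance (m : M) : AddZeroClass (Jet E m) := inferInstance
instance (m : M) : Module ℝ (Jet E m) := inferInstance

/-- The first jet `[u]_m` of a vector field. -/
def jet (m : M) : VField E M →ₗ[ℝ] Jet E m := (jetNull m).mkQ

lemma jet_eq_iff (m : M) (u v : VField E M) :
    jet m u = jet m v ↔ u m = v m ∧ ∀ ξ : OneForm E M,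
      mvfderiv 𝓘(ℝ, E) (contract ξ u) m = mvfderiv 𝓘(ℝ, E) (contract ξ v) m := by
  have h : u - v ∈ jetNull m ↔ (u - v) m = 0 ∧
      ∀ ξ : OneForm E M, mvfderiv 𝓘(ℝ, E) (contract ξ (u - v)) m = 0 := Iff.rfl
  have h2 : u - v = u + (-1 : ℝ) • v := by simp [sub_eq_add_neg]
  rw [jet, Submodule.mkQ_apply, Submodule.mkQ_apply, Submodule.Quotient.eq, h]
  refine and_congr (by simp [sub_eq_zero]) (forall_congr' fun ξ => ?_)
  rw [h2, contract_add, contract_smul, mvfderiv_fn_add, mvfderiv_fn_smul, neg_one_smul,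
    ← sub_eq_add_neg, sub_eq_zero]

lemma jet_induction {m : M} {P : Jet E m → Prop} (h : ∀ u, P (jet m u)) (μ : Jet E m) : P μ :=
  Submodule.Quotient.induction_on _ μ h

/-- The projection `𝕡 : 𝔍(TM)_m → T_m M`, `[u]_m ↦ u(m)`. -/
def jetProj (m : M) : Jet E m →ₗ[ℝ] Tang E m :=
  (jetNull m).liftQ { toFun := fun u => u m, map_add' := fun _ _ => rfl, map_smul' := fun _ _ => rfl }
    (fun _ hu => hu.1)

@[simp] lemma jetProj_jet (m : M) (u : VField E M) : jetProj m (jet m u) = u m := rfl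

variable [FiniteDimensional ℝ E] [T2Space M]

lemma sum_coframe_fsmul (m : M) (u : VField E M) :
    fsmul (bumpFn E m * bumpFn E m) u = ∑ i, fsmul (contract (coframe m i) u) (frame m i) := by
  ext p
  have : ∀ (s : Finset (Fin (Module.finrank ℝ E))) (w : Fin (Module.finrank ℝ E) → VField E M),
      (∑ i ∈ s, w i) p = ∑ i ∈ s, w i p := by
    intro s w
    exact map_sum ({ toFun := fun u => u p, map_zero' := rfl, map_add' := fun _ _ => rfl } :
      VField E M →+ Tang E p) w s
  rw [this]
  exact (sum_coframe m p (u p)).symm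

lemma gaugeOp_eq_zero {m : M} (d : Gauge E m) {u : VField E M} (hu : u ∈ jetNull m) :
    gaugeOp m d u = 0 := by
  have h1 := gaugeOp_fsmul d (bumpFn E m * bumpFn E m) u
  rw [sum_coframe_fsmul, map_sum, hu.1, smul_zero, add_zero] at h1
  have h2 : (bumpFn E m * bumpFn E m) m = 1 := by
    change bumpFn E m m * bumpFn E m m = 1; simp
  rw [h2, one_smul] at h1
  rw [← h1]
  refine Finset.sum_eq_zero fun i _ => ?_
  rw [gaugeOp_fsmul, hu.2, contract_apply, hu.1, map_zero]
  have h3 : (0 : Tang E m →L[ℝ] ℝ) (gaugeAnchor m d) = 0 := rfl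
  have h4 : ∀ a b : Tang E m, (0 : ℝ) • a + (0 : ℝ) • b = 0 := fun a b => by simp
  rw [h3]
  exact h4 _ _

lemma gaugeOp_eq_zero_of_anchor {m : M} (d : Gauge E m) (hd : gaugeAnchor m d = 0)
    {u : VField E M} (hu : u m = 0) : gaugeOp m d u = 0 := by
  have h1 := gaugeOp_fsmul d (bumpFn E m * bumpFn E m) u
  rw [sum_coframe_fsmul, map_sum, hu, smul_zero, add_zero] at h1
  have h2 : (bumpFn E m * bumpFn E m) m = 1 := by
    change bumpFn E m m * bumpFn E m m = 1; simp
  rw [h2, one_smul] at h1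
  rw [← h1]
  refine Finset.sum_eq_zero fun i _ => ?_
  rw [gaugeOp_fsmul, hd, contract_apply, hu, map_zero, map_zero]
  have h4 : ∀ a b : Tang E m, (0 : ℝ) • a + (0 : ℝ) • b = 0 := fun a b => by simp
  exact h4 _ _

/-- The `TM`-valued pairing between `𝔍(TM)_m` and `𝔇(TM)_m`: `⟨[u]_m, d⟩ = d(u)`. -/
def pairing (m : M) : Jet E m →ₗ[ℝ] Gauge E m →ₗ[ℝ] Tang E m :=
  (jetNull m).liftQ (gaugeOp m).flip (fun _ hu => LinearMap.ext fun d => gaugeOp_eq_zero d hu)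

@[simp] lemma pairing_jet (m : M) (u : VField E M) (d : Gauge E m) :
    pairing m (jet m u) d = gaugeOp m d u := rfl

/-- The bundle map `π : 𝔍(TM) → 𝔇(TM)` attached to the Lie algebroid `TM`, determined by
`π([u]_m) = [u, ·](m)`. -/
def jetToGauge (m : M) : Jet E m →ₗ[ℝ] Gauge E m :=
  (jetNull m).liftQ (adAt m) (fun u hu => gauge_ext (fun v => by
    change vbracket u v m = 0
    rw [vbracket_swap]
    change - gaugeOp m (adAt m v) u = 0
    rw [gaugeOp_eq_zero _ hu, neg_zero]) hu.1)

@[simp] lemma jetToGauge_jet (m : M) (u : VField E M) : jetToGauge m (jet m u) = adAt m u := rfl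

lemma gaugeOp_jetToGauge (m : M) (μ : Jet E m) (v : VField E M) :
    gaugeOp m (jetToGauge m μ) v = - pairing m μ (adAt m v) := by
  induction μ using jet_induction with
  | h u =>
    rw [jetToGauge_jet, pairing_jet, gaugeOp_adAt, gaugeOp_adAt, vbracket_swap]; rfl

lemma gaugeAnchor_jetToGauge (m : M) (μ : Jet E m) :
    gaugeAnchor m (jetToGauge m μ) = jetProj m μ := by
  induction μ using jet_induction with
  | h u => rfl

lemma pairing_gaugeEmbed (m : M) (μ : Jet E m) (Φ : Tang E m →L[ℝ] Tang E m) :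
    pairing m μ (gaugeEmbed m Φ) = Φ (jetProj m μ) := by
  induction μ using jet_induction with
  | h u => rfl

/-- The inclusion `𝕖 : Hom(T_m M, T_m M) → 𝔍(TM)_m`: `𝕖(y)` is the jet at `m` of a vector field
which, in the preferred chart at `m` and near `m`, is `p ↦ y(p - m)`. -/
def jetEmbed (m : M) : (Tang E m →L[ℝ] Tang E m) →ₗ[ℝ] Jet E m where
  toFun y := jet m (∑ i, ∑ j, (tbasis E m).repr (y (tbasis E m i)) j •
    fsmul (coordFn m i) (frame m j))
  map_add' := by
    intro y z
    rw [← map_add, ← Finset.sum_add_distrib]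
    congr 1
    refine Finset.sum_congr rfl fun i _ => ?_
    rw [← Finset.sum_add_distrib]
    refine Finset.sum_congr rfl fun j _ => ?_
    rw [← add_smul]
    congr 1
    simp
  map_smul' := by
    intro c y
    rw [RingHom.id_apply, ← map_smul, Finset.smul_sum]
    congr 1
    refine Finset.sum_congr rfl fun i _ => ?_
    rw [Finset.smul_sum]
    refine Finset.sum_congr rfl fun j _ => ?_
    rw [smul_smul]
    congr 1
    simp

/-- `⟨𝕖(y), d⟩ = y(α(d))`. -/
lemma pairing_jetEmbed (m : M) (y : Tang E m →L[ℝ] Tang E m) (d : Gauge E m) :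
    pairing m (jetEmbed m y) d = y (gaugeAnchor m d) := by
  change gaugeOp m d _ = _
  rw [map_sum]
  have h0 : ∀ i : Fin (Module.finrank ℝ E), gaugeOp m d (∑ j,
      (tbasis E m).repr (y (tbasis E m i)) j • fsmul (coordFn m i) (frame m j))
      = (tbasis E m).repr (gaugeAnchor m d) i • y (tbasis E m i) := by
    intro i
    rw [map_sum]
    have h1 : ∀ j : Fin (Module.finrank ℝ E), gaugeOp m d
        ((tbasis E m).repr (y (tbasis E m i)) j •
          fsmul (coordFn m i) (frame m j))
        = (tbasis E m).repr (gaugeAnchor m d) i •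
          ((tbasis E m).repr (y (tbasis E m i)) j •
            tbasis E m j) := by
      intro j
      rw [map_smul, gaugeOp_fsmul, coordFn_self, zero_smul, zero_add, mvfderiv_coordFn, frame_self,
        smul_comm]
    rw [Finset.sum_congr rfl fun j _ => h1 j, ← Finset.smul_sum]
    congr 1
    exact (tbasis E m).sum_repr (y (tbasis E m i) )
  rw [Finset.sum_congr rfl fun i _ => h0 i]
  have h2 : gaugeAnchor m d = ∑ i, (tbasis E m).repr (gaugeAnchor m d) i •
      tbasis E m i :=
    ((tbasis E m).sum_repr (gaugeAnchor m d )).symm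
  conv_rhs => rw [h2]
  rw [map_sum]
  exact Finset.sum_congr rfl fun i _ => (map_smul y _ _).symm

end Jets

section JetSections

variable {E : Type*} [NormedAddCommGroup E] [NormedSpace ℝ E] [FiniteDimensional ℝ E]
  {M : Type*} [TopologicalSpace M] [ChartedSpace E M] [IsManifold 𝓘(ℝ, E) ∞ M] [T2Space M]

/-- `Γ(𝔍(TM))`: a section is smooth when its pairing with every smooth section of `𝔇(TM)` is a
smooth vector field. -/
def jetSections : Submodule ℝ (∀ m : M, Jet E m) where
  carrier := {μ | ∀ d : GaugeSec E M, ContMDiff 𝓘(ℝ, E) 𝓘(ℝ, E).tangent ∞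
    (fun m => (⟨m, pairing m (μ m) (d.1 m)⟩ : TangentBundle 𝓘(ℝ, E) M))}
  add_mem' := by
    intro a b ha hb d
    simpa using! (ha d).add_section (hb d)
  zero_mem' := by
    intro d
    simpa using! (0 : VField E M).contMDiff
  smul_mem' := by
    intro c a ha d
    simpa using! (ha d).const_smul_section (a := c)

variable (E M) in
/-- The type `Γ(𝔍(TM))`. -/
abbrev JetSec : Type _ := ↥(jetSections (E := E) (M := M))

instance : AddCommGroup (JetSec E M) := inferInstance
instance : AddCommMonoid (JetSec E M) := inferInstance
instance : AddGroup (JetSec E M) := inferInstance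
instance : AddMonoid (JetSec E M) := inferInstance
instance : AddZeroClass (JetSec E M) := inferInstance
instance : Module ℝ (JetSec E M) := inferInstance

/-- The pairing of a smooth section of `𝔍(TM)` with a smooth section of `𝔇(TM)`. -/
def pairSec (μ : JetSec E M) (d : GaugeSec E M) : VField E M :=
  ⟨fun m => pairing m (μ.1 m) (d.1 m), μ.2 d⟩

lemma pairSec_apply (μ : JetSec E M) (d : GaugeSec E M) (m : M) :
    pairSec μ d m = pairing m (μ.1 m) (d.1 m) := rfl

/-- The prolongation `𝕕u : m ↦ [u]_m` of a vector field. -/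
def prolong (u : VField E M) : JetSec E M := ⟨fun m => jet m u, fun d => (gact d u).contMDiff⟩

lemma pairSec_prolong (u : VField E M) (d : GaugeSec E M) : pairSec (prolong u) d = gact d u := rfl

/-- The identity operator of `TM`, as a smooth section of `𝔇(TM)`. -/
def gaugeOne : GaugeSec E M :=
  ⟨fun m => gaugeEmbed m (ContinuousLinearMap.id ℝ _),
    fun u => u.contMDiff, (0 : VField E M).contMDiff⟩

/-- The product of a smooth function and a smooth section of `𝔇(TM)`. -/
def gsmul (f : SmoothFn E M) (d : GaugeSec E M) : GaugeSec E M :=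
  ⟨fun m => f m • d.1 m, fun u => by simpa using! (fsmul f (gact d u)).contMDiff,
    by simpa using! (fsmul f (ganchor d)).contMDiff⟩

lemma gact_gsmul (f : SmoothFn E M) (d : GaugeSec E M) (u : VField E M) :
    gact (gsmul f d) u = fsmul f (gact d u) := by
  ext m; simp [gact_apply, gsmul]

lemma ganchor_gsmul (f : SmoothFn E M) (d : GaugeSec E M) :
    ganchor (gsmul f d) = fsmul f (ganchor d) := by
  ext m; simp [ganchor_apply, gsmul]

lemma gact_add (d d' : GaugeSec E M) (u : VField E M) : gact (d + d') u = gact d u + gact d' u := by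
  ext m; simp [gact_apply]

lemma gact_sub (d d' : GaugeSec E M) (u : VField E M) : gact (d - d') u = gact d u - gact d' u := by
  ext m; simp [gact_apply]

lemma gact_map_add (d : GaugeSec E M) (u v : VField E M) : gact d (u + v) = gact d u + gact d v := by
  ext m; simp [gact_apply]

lemma gact_map_sub (d : GaugeSec E M) (u v : VField E M) : gact d (u - v) = gact d u - gact d v := by
  ext m; simp [gact_apply]

lemma ganchor_add (d d' : GaugeSec E M) : ganchor (d + d') = ganchor d + ganchor d' := by
  ext m; simp [ganchor_apply]

lemma ganchor_sub (d d' : GaugeSec E M) : ganchor (d - d') = ganchor d - ganchor d' := by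
  ext m; simp [ganchor_apply]

lemma gsec_ext {d d' : GaugeSec E M} (h : ∀ u, gact d u = gact d' u)
    (h' : ganchor d = ganchor d') : d = d' := by
  apply Subtype.ext
  funext m
  refine gauge_ext (fun u => ?_) ?_
  · exact congrArg (fun s : VField E M => s m) (h u)
  · exact congrArg (fun s : VField E M => s m) h'

lemma gact_ad (u v : VField E M) : gact (ad u) v = vbracket u v := rfl

lemma ganchor_ad (u : VField E M) : ganchor (ad u) = u := rfl

lemma field_sum_apply (s : Finset (Fin (Module.finrank ℝ E)))
    (w : Fin (Module.finrank ℝ E) → VField E M) (p : M) : (∑ i ∈ s, w i) p = ∑ i ∈ s, w i p :=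
  map_sum ({ toFun := fun u => u p, map_zero' := rfl, map_add' := fun _ _ => rfl } :
    VField E M →+ Tang E p) w s

/-- Every `C^∞(M)`-linear map `R : Γ(𝔇(TM)) → Γ(TM)` with `R(Φ) = Φ(R(1))` for `Φ` in
`Γ(𝔤𝔩(TM))` is the pairing with a smooth section of `𝔍(TM)`. -/
lemma exists_jetSec (R : GaugeSec E M →+ VField E M)
    (hsmul : ∀ f d, R (gsmul f d) = fsmul f (R d))
    (hgl : ∀ d, ganchor d = 0 → R d = gact d (R gaugeOne)) :
    ∃ μ : JetSec E M, ∀ d, pairSec μ d = R d := by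
  have hR : ∀ d, R d = gact d (R gaugeOne) + (R (ad (ganchor d)) -
      gact (ad (ganchor d)) (R gaugeOne)) := by
    intro d
    have h := hgl (d - ad (ganchor d)) (by rw [ganchor_sub, ganchor_ad, sub_self])
    rw [R.map_sub, gact_sub] at h
    rw [sub_eq_sub_iff_add_eq_add] at h
    rw [add_sub, ← h]; abel
  set S : VField E M →+ VField E M :=
    { toFun := fun x => R (ad x) - gact (ad x) (R gaugeOne)
      map_zero' := by
        have h : ad (0 : VField E M) = 0 := by
          apply Subtype.ext; funext m; exact map_zero (adAt m)
        rw [h, map_zero]; ext m; simp [gact_apply]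
      map_add' := by
        intro x y
        have h : ad (x + y) = ad x + ad y := by
          apply Subtype.ext; funext m; exact map_add (adAt m) x y
        rw [h, map_add, gact_add]; abel } with hS
  have hSf : ∀ f x, S (fsmul f x) = fsmul f (S x) := by
    intro f x
    have h := hgl (ad (fsmul f x) - gsmul f (ad x)) (by
      rw [ganchor_sub, ganchor_gsmul, ganchor_ad, ganchor_ad, sub_self])
    rw [R.map_sub, gact_sub, hsmul, gact_gsmul] at h
    change R (ad (fsmul f x)) - gact (ad (fsmul f x)) (R gaugeOne)
      = fsmul f (R (ad x) - gact (ad x) (R gaugeOne))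
    have h3 : fsmul f (R (ad x) - gact (ad x) (R gaugeOne))
        = fsmul f (R (ad x)) - fsmul f (gact (ad x) (R gaugeOne)) := by
      ext m; simp [smul_sub]
    rw [h3, sub_eq_sub_iff_add_eq_add]
    rw [sub_eq_sub_iff_add_eq_add] at h
    rw [h]; abel
  have hpt : ∀ (x : VField E M) (m : M), S x m = ∑ i, coframe m i m (x m) • S (frame m i) m := by
    intro x m
    have h1 : S (fsmul (bumpFn E m * bumpFn E m) x) m = S x m := by
      rw [hSf]
      change (bumpFn E m m * bumpFn E m m) • S x m = _
      simp
    rw [← h1, sum_coframe_fsmul, map_sum, field_sum_apply]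
    refine Finset.sum_congr rfl fun i _ => ?_
    rw [hSf]; rfl
  let y : ∀ m : M, Tang E m →L[ℝ] Tang E m := fun m =>
    ∑ i, ((coframe m i m : Tang E m →L[ℝ] ℝ)).smulRight (S (frame m i) m)
  have hy : ∀ (x : VField E M) (m : M), y m (x m) = S x m := by
    intro x m
    rw [hpt]
    simp only [y, sum_apply]
    rfl
  have hpair : ∀ (d : GaugeSec E M) (m : M),
      pairing m (jet m (R gaugeOne) + jetEmbed m (y m)) (d.1 m) = R d m := by
    intro d m
    rw [map_add, LinearMap.add_apply, pairing_jet, pairing_jetEmbed, ← ganchor_apply, hy, hR d]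
    rfl
  refine ⟨⟨fun m => jet m (R gaugeOne) + jetEmbed m (y m), fun d => ?_⟩, fun d => ?_⟩
  · simp only [hpair]; exact (R d).contMDiff
  · ext m; exact hpair d m

/-- The defining formula of the Lie derivative `𝔏_d μ` of a smooth section of `𝔍(TM)`:
`⟨𝔏_d μ, d'⟩ = d⟨μ, d'⟩ - ⟨μ, [d, d']⟩`. -/
lemma exists_lieDeriv (d : GaugeSec E M) (μ : JetSec E M) :
    ∃ κ : JetSec E M, ∀ d' : GaugeSec E M,
      pairSec κ d' = gact d (pairSec μ d') - pairSec μ (gaugeBracket d d') := by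
  have hb_add : ∀ d₁ d₂ : GaugeSec E M,
      gaugeBracket d (d₁ + d₂) = gaugeBracket d d₁ + gaugeBracket d d₂ := by
    intro d₁ d₂
    refine gsec_ext (fun u => ?_) ?_
    · simp only [gact_gaugeBracket, gact_add, gact_map_add]; abel
    · simp only [ganchor_gaugeBracket, ganchor_add, vbracket_add_right]
  have hp_add : ∀ d₁ d₂ : GaugeSec E M, pairSec μ (d₁ + d₂) = pairSec μ d₁ + pairSec μ d₂ := by
    intro d₁ d₂; ext m; simp [pairSec_apply]
  have hp_smul : ∀ f (d₁ : GaugeSec E M), pairSec μ (gsmul f d₁) = fsmul f (pairSec μ d₁) := by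
    intro f d₁; ext m; simp [pairSec_apply, gsmul]
  have hb_smul : ∀ f (d₁ : GaugeSec E M),
      gaugeBracket d (gsmul f d₁) = gsmul f (gaugeBracket d d₁) + gsmul (dir (ganchor d) f) d₁ := by
    intro f d₁
    refine gsec_ext (fun u => ?_) ?_
    · simp only [gact_gaugeBracket, gact_add, gact_gsmul, gact_fsmul]
      ext m; simp [smul_sub]; abel
    · simp only [ganchor_gaugeBracket, ganchor_add, ganchor_gsmul, vbracket_fsmul_right]
  have hp_gl : ∀ d₁ : GaugeSec E M, ganchor d₁ = 0 →
      pairSec μ d₁ = gact d₁ (pairSec μ gaugeOne) := by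
    intro d₁ h₁
    ext m
    have ha : gaugeAnchor m (d₁.1 m) = 0 := congrArg (fun s : VField E M => s m) h₁
    change pairing m (μ.1 m) (d₁.1 m) = gaugeOp m (d₁.1 m) (pairSec μ gaugeOne)
    have hone : pairSec μ gaugeOne m = jetProj m (μ.1 m) := pairing_gaugeEmbed m (μ.1 m) _
    generalize pairSec μ gaugeOne = w at hone
    generalize μ.1 m = μm at hone ⊢
    induction μm using jet_induction with
    | h u =>
      rw [pairing_jet, ← sub_eq_zero, ← map_sub]
      refine gaugeOp_eq_zero_of_anchor _ ha ?_
      change u m - w m = 0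
      rw [hone, jetProj_jet, sub_self]
  obtain ⟨κ, hκ⟩ := exists_jetSec
    ({ toFun := fun d' => gact d (pairSec μ d') - pairSec μ (gaugeBracket d d')
       map_zero' := by
        have h0 : ∀ X : GaugeSec E M, X + X = X → X = 0 := fun X h => by simpa using h
        have h1 : pairSec μ 0 = 0 := by ext m; simp [pairSec_apply]
        have h2 : gaugeBracket d 0 = 0 := h0 _ (by rw [← hb_add, add_zero])
        rw [h1, h2, h1]; ext m; simp [gact_apply]
       map_add' := by
        intro d₁ d₂
        rw [hb_add, hp_add, hp_add, gact_map_add]; abel } : GaugeSec E M →+ VField E M)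
    (by
      intro f d'
      simp only [AddMonoidHom.coe_mk, ZeroHom.coe_mk]
      rw [hp_smul, hb_smul, hp_add, hp_smul, hp_smul, gact_fsmul]
      ext m; simp [smul_sub])
    (by
      intro d' hd'
      simp only [AddMonoidHom.coe_mk, ZeroHom.coe_mk]
      have h1 : gaugeBracket d gaugeOne = 0 := by
        refine gsec_ext (fun u => ?_) ?_
        · rw [gact_gaugeBracket]
          have : ∀ v : VField E M, gact gaugeOne v = v := fun v => rfl
          rw [this, this, sub_self]; ext m; simp [gact_apply]
        · rw [ganchor_gaugeBracket]
          have : ganchor (gaugeOne : GaugeSec E M) = 0 := rfl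
          rw [this]
          have := vbracket_smul_right (ganchor d) 0 0
          rw [zero_smul, zero_smul] at this
          rw [this]; rfl
      have h2 : ganchor (gaugeBracket d d') = 0 := by
        rw [ganchor_gaugeBracket, hd']
        have := vbracket_smul_right (ganchor d) 0 0
        rwa [zero_smul, zero_smul] at this
      have h3 : pairSec μ (0 : GaugeSec E M) = 0 := by ext m; simp [pairSec_apply]
      rw [h1, h3, sub_zero, hp_gl d' hd', hp_gl _ h2, gact_gaugeBracket]
      abel)
  exact ⟨κ, hκ⟩

/-- The Lie derivative `𝔏_d μ` of a smooth section of `𝔍(TM)` along a smooth section of `𝔇(TM)`. -/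
def lieDeriv (d : GaugeSec E M) (μ : JetSec E M) : JetSec E M := (exists_lieDeriv d μ).choose

lemma pairSec_lieDeriv (d : GaugeSec E M) (μ : JetSec E M) (d' : GaugeSec E M) :
    pairSec (lieDeriv d μ) d' = gact d (pairSec μ d') - pairSec μ (gaugeBracket d d') :=
  (exists_lieDeriv d μ).choose_spec d'

/-- The map induced by `π` on smooth sections. -/
def jetPi (μ : JetSec E M) : GaugeSec E M :=
  ⟨fun m => jetToGauge m (μ.1 m), fun v => by
      simp only [gaugeOp_jetToGauge]
      exact (-pairSec μ (ad v)).contMDiff, by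
      simp only [gaugeAnchor_jetToGauge]
      have h : ∀ m, jetProj m (μ.1 m) = pairSec μ gaugeOne m := fun m =>
        (pairing_gaugeEmbed m (μ.1 m) (ContinuousLinearMap.id ℝ _)).symm
      simp only [h]
      exact (pairSec μ gaugeOne).contMDiff⟩

/-- The bracket of `Γ(𝔍(TM))`:
`[μ, ν] = 𝔏_{π(μ)} ν - 𝔏_{π(ν)} μ - 𝕕⟨π(μ), ν⟩`. -/
def jetBracket (μ ν : JetSec E M) : JetSec E M :=
  lieDeriv (jetPi μ) ν - lieDeriv (jetPi ν) μ - prolong (pairSec ν (jetPi μ))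

end JetSections

/-! ### Lie algebroids -/

section Algebroids

variable {E : Type*} [NormedAddCommGroup E] [NormedSpace ℝ E]
  {M : Type*} [TopologicalSpace M] [ChartedSpace E M]

variable (E) in
/-- A family `A` of real vector spaces over `M`, together with a space of sections, an anchor and
a bracket of sections (so far subject to no axiom). -/
structure AlgebroidData (A : M → Type*) [∀ m, AddCommGroup (A m)] [∀ m, Module ℝ (A m)] where
  /-- the smooth sections -/
  sections : Submodule ℝ (∀ m, A m)
  /-- the anchor -/
  anchor : ∀ m, A m →ₗ[ℝ] Tang E m
  /-- the bracket of smooth sections -/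
  bracket : sections → sections → sections

section Axioms

variable {A B C : M → Type*}
  [∀ m, AddCommGroup (A m)] [∀ m, Module ℝ (A m)]
  [∀ m, AddCommGroup (B m)] [∀ m, Module ℝ (B m)]
  [∀ m, AddCommGroup (C m)] [∀ m, Module ℝ (C m)]

variable [IsManifold 𝓘(ℝ, E) ∞ M]

variable (E) in
/-- The family `A` of vector spaces carries the structure of a smooth vector bundle over `M` with
model fibre `F`, the smooth sections of which are exactly the elements of `Γ`. (Such a structure
is determined by `Γ`.) -/
def IsSmoothVectorBundle (F : Type*) [NormedAddCommGroup F] [NormedSpace ℝ F]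
    (Γ : Submodule ℝ (∀ m, A m)) : Prop :=
  ∃ (_ : TopologicalSpace (TotalSpace F A)) (_ : ∀ m, TopologicalSpace (A m))
    (_ : FiberBundle F A) (_ : VectorBundle ℝ F A),
    ContMDiffVectorBundle ∞ F A 𝓘(ℝ, E) ∧
    ∀ s : ∀ m, A m, s ∈ Γ ↔
      ContMDiff 𝓘(ℝ, E) (𝓘(ℝ, E).prod 𝓘(ℝ, F)) ∞ (fun m => TotalSpace.mk' F m (s m))

/-- The axioms of a Lie algebroid over `M`, the underlying vector bundle having model fibre `F`. -/
structure IsLieAlgebroid (F : Type*) [NormedAddCommGroup F] [NormedSpace ℝ F]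
    (𝒜 : AlgebroidData E A) : Prop where
  smoothBundle : IsSmoothVectorBundle E F 𝒜.sections
  anchor_smooth : ∀ s ∈ 𝒜.sections, ContMDiff 𝓘(ℝ, E) 𝓘(ℝ, E).tangent ∞
    (fun m => (⟨m, 𝒜.anchor m (s m)⟩ : TangentBundle 𝓘(ℝ, E) M))
  bracket_add : ∀ s t t', 𝒜.bracket s (t + t') = 𝒜.bracket s t + 𝒜.bracket s t'
  bracket_smul : ∀ (c : ℝ) (s t), 𝒜.bracket s (c • t) = c • 𝒜.bracket s t
  bracket_skew : ∀ s t, 𝒜.bracket s t = - 𝒜.bracket t s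
  jacobi : ∀ s t r, 𝒜.bracket s (𝒜.bracket t r)
    = 𝒜.bracket (𝒜.bracket s t) r + 𝒜.bracket t (𝒜.bracket s r)
  leibniz : ∀ (f : SmoothFn E M) (s t ft : 𝒜.sections), (∀ m, ft.1 m = f m • t.1 m) →
    ∀ m, (𝒜.bracket s ft).1 m = f m • (𝒜.bracket s t).1 m
      + mvfderiv 𝓘(ℝ, E) f m (𝒜.anchor m (s.1 m)) • t.1 m
  anchor_bracket : ∀ s t m, 𝒜.anchor m ((𝒜.bracket s t).1 m) =
    mlieBracket 𝓘(ℝ, E) (fun p => 𝒜.anchor p (s.1 p)) (fun p => 𝒜.anchor p (t.1 p)) m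

/-- A bundle map over the identity of `M` is a morphism of Lie algebroids if it is smooth and
compatible with anchors and brackets. -/
structure IsAlgebroidHom (𝒜 : AlgebroidData E A) (ℬ : AlgebroidData E B)
    (φ : ∀ m, A m →ₗ[ℝ] B m) : Prop where
  map_sections : ∀ s ∈ 𝒜.sections, (fun m => φ m (s m)) ∈ ℬ.sections
  map_anchor : ∀ m a, ℬ.anchor m (φ m a) = 𝒜.anchor m a
  map_bracket : ∀ (s t : 𝒜.sections) (m : M), φ m ((𝒜.bracket s t).1 m) =
    (ℬ.bracket ⟨fun p => φ p (s.1 p), map_sections s.1 s.2⟩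
      ⟨fun p => φ p (t.1 p), map_sections t.1 t.2⟩).1 m

/-- An isomorphism of Lie algebroids over the identity of `M`. -/
def IsAlgebroidIso (𝒜 : AlgebroidData E A) (ℬ : AlgebroidData E B)
    (φ : ∀ m, A m ≃ₗ[ℝ] B m) : Prop :=
  IsAlgebroidHom 𝒜 ℬ (fun m => (φ m).toLinearMap) ∧
    IsAlgebroidHom ℬ 𝒜 (fun m => (φ m).symm.toLinearMap)

/-- Exactness of `0 → A → B → C → 0` in each fibre. -/
def IsShortExact (i : ∀ m, A m →ₗ[ℝ] B m) (p : ∀ m, B m →ₗ[ℝ] C m) : Prop :=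
  ∀ m, Function.Injective (i m) ∧ Function.Exact (i m) (p m) ∧ Function.Surjective (p m)

end Axioms

variable [IsManifold 𝓘(ℝ, E) ∞ M] [FiniteDimensional ℝ E]

variable (E M) in
/-- `TM` with its standard Lie algebroid structure. -/
def tangentAlgebroid : AlgebroidData E (fun m : M => Tang E m) where
  sections :=
    { carrier := {u | ContMDiff 𝓘(ℝ, E) 𝓘(ℝ, E).tangent ∞
        (fun m => (⟨m, u m⟩ : TangentBundle 𝓘(ℝ, E) M))}
      add_mem' := fun ha hb => ContMDiff.add_section ha hb
      zero_mem' := (0 : VField E M).contMDiff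
      smul_mem' := fun _ _ ha => ContMDiff.const_smul_section ha }
  anchor := fun _ => LinearMap.id
  bracket := fun u v => ⟨vbracket ⟨u.1, u.2⟩ ⟨v.1, v.2⟩, (vbracket _ _).contMDiff⟩

variable (E M) in
/-- Smooth sections of `𝔤𝔩(TM) = Hom(TM, TM)`. -/
def glSections : Submodule ℝ (∀ m : M, Tang E m →L[ℝ] Tang E m) where
  carrier := {y | ContMDiff 𝓘(ℝ, E) (𝓘(ℝ, E).prod 𝓘(ℝ, E →L[ℝ] E)) ∞
    (fun m => TotalSpace.mk' (E →L[ℝ] E) (E := fun p : M => Tang E p →L[ℝ] Tang E p) m (y m))}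
  add_mem' := fun ha hb => ContMDiff.add_section ha hb
  zero_mem' := (0 : Cₛ^∞⟮𝓘(ℝ, E); E →L[ℝ] E, (fun p : M => Tang E p →L[ℝ] Tang E p)⟯).contMDiff
  smul_mem' := fun _ _ ha => ContMDiff.const_smul_section ha

lemma glSections_comp {y z : ∀ m : M, Tang E m →L[ℝ] Tang E m}
    (hy : y ∈ glSections E M) (hz : z ∈ glSections E M) :
    (fun m => (y m).comp (z m)) ∈ glSections E M := by
  intro x
  have hy' := ((contMDiffAt_hom_bundle _).1 (hy x)).2
  have hz' := ((contMDiffAt_hom_bundle _).1 (hz x)).2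
  refine (contMDiffAt_hom_bundle _).2 ⟨contMDiffAt_id, ?_⟩
  refine (hy'.clm_comp hz').congr_of_eventuallyEq ?_
  have hx : x ∈ (trivializationAt E (fun p : M => Tang E p) x).baseSet :=
    mem_baseSet_trivializationAt E _ x
  filter_upwards [(trivializationAt E (fun p : M => Tang E p) x).open_baseSet.mem_nhds hx]
    with p hp
  ext v
  simp only [ContinuousLinearMap.inCoordinates, ContinuousLinearMap.comp_apply]
  rw [Trivialization.symmL_continuousLinearMapAt _ hp]

variable (E M) in
/-- `𝔤𝔩(TM)`, with the commutator bracket and anchor zero. -/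
def glAlgebroid : AlgebroidData E (fun m : M => Tang E m →L[ℝ] Tang E m) where
  sections := glSections E M
  anchor := fun _ => 0
  bracket := fun y z => ⟨fun m => (y.1 m).comp (z.1 m) - (z.1 m).comp (y.1 m),
    (glSections E M).sub_mem (glSections_comp y.2 z.2) (glSections_comp z.2 y.2)⟩

variable (E M) in
/-- `𝔤𝔩(TM)^op`, with the opposite of the commutator bracket and anchor zero. -/
def glOpAlgebroid : AlgebroidData E (fun m : M => Tang E m →L[ℝ] Tang E m) where
  sections := glSections E M
  anchor := fun _ => 0
  bracket := fun y z => (glAlgebroid E M).bracket z y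

variable (E M) in
/-- The gauge algebroid `𝔇(TM)`. -/
def gaugeAlgebroid : AlgebroidData E (fun m : M => Gauge E m) where
  sections := gaugeSections
  anchor := gaugeAnchor
  bracket := gaugeBracket

variable [T2Space M]

variable (E M) in
/-- The jet algebroid `𝔍(TM)` of the Lie algebroid `TM`; its anchor `α ∘ π` is `𝕡`. -/
def jetAlgebroid : AlgebroidData E (fun m : M => Jet E m) where
  sections := jetSections
  anchor := fun m => (gaugeAnchor m).comp (jetToGauge m)
  bracket := jetBracket

end Algebroids

end JetGauge

end

/-!
Everything happens inside `𝔇(TM)`. An operator with zero anchor is tensorial, hence an endomorphism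
of the fibre: this is the exactness of the Atiyah sequence. If `[u, ·](m) = 0`, then evaluating the
operators `[ad X, ξ ⊗ w]`, whose anchor vanishes, on `u` shows that `u` has vanishing first jet at
`m`. So `π` is injective on fibres; it is surjective because every `𝔡` with anchor `X(m)` has the
form `[X, ·](m) + 𝕚(Φ)`. The same decomposition recovers the pairing from `π`:
`⟨μ, 𝔡⟩ = 𝔡(w) - π(μ)(X) - [X, w](m)` whenever `X(m) = α(𝔡)` and `w(m) = 𝕡(μ)`.
Hence `π` identifies smooth sections with smooth sections, and with the Jacobi identity it takes
the bracket of `𝔍(TM)` to the commutator.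

Thus `𝔤𝔩(TM)`, `𝔤𝔩(TM)^op` and `𝔍(TM)` all map to `𝔇(TM)` injectively on fibres and compatibly with
anchors and brackets, so they inherit its Lie algebroid axioms. A local frame `eₖ` of `TM` with dual
coframe `εᵏ` makes `𝔇(TM)` and `𝔍(TM)` vector bundles: the endomorphisms `εⁱ ⊗ eⱼ` and the
operators lifting `eₖ` and annihilating all the `eᵢ` form a frame of `𝔇(TM)`.
-/

noncomputable section

namespace JetGauge

section Morphisms

variable {E : Type*} [NormedAddCommGroup E] [NormedSpace ℝ E]
  {M : Type*} [TopologicalSpace M] [ChartedSpace E M]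
  {A B C : M → Type*}
  [∀ m, AddCommGroup (A m)] [∀ m, Module ℝ (A m)]
  [∀ m, AddCommGroup (B m)] [∀ m, Module ℝ (B m)]
  [∀ m, AddCommGroup (C m)] [∀ m, Module ℝ (C m)]
  {𝒜 : AlgebroidData E A} {ℬ : AlgebroidData E B} {𝒞 : AlgebroidData E C}

namespace IsAlgebroidHom

/-- The linear map between spaces of smooth sections induced by a morphism of Lie algebroids. -/
def mapSections {φ : ∀ m, A m →ₗ[ℝ] B m} (h : IsAlgebroidHom 𝒜 ℬ φ) :
    𝒜.sections →ₗ[ℝ] ℬ.sections where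
  toFun s := ⟨fun m => φ m (s.1 m), h.map_sections s.1 s.2⟩
  map_add' s t := Subtype.ext <| funext fun m => map_add (φ m) (s.1 m) (t.1 m)
  map_smul' c s := Subtype.ext <| funext fun m => map_smul (φ m) c (s.1 m)

lemma mapSections_bracket {φ : ∀ m, A m →ₗ[ℝ] B m} (h : IsAlgebroidHom 𝒜 ℬ φ)
    (s t : 𝒜.sections) :
    h.mapSections (𝒜.bracket s t) = ℬ.bracket (h.mapSections s) (h.mapSections t) :=
  Subtype.ext <| funext <| h.map_bracket s t

lemma mapSections_injective {φ : ∀ m, A m →ₗ[ℝ] B m} (h : IsAlgebroidHom 𝒜 ℬ φ)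
    (hφ : ∀ m, Function.Injective (φ m)) : Function.Injective h.mapSections := fun _ _ hst =>
  Subtype.ext <| funext fun m => hφ m <| congrFun (Subtype.ext_iff.1 hst) m

lemma comp {φ : ∀ m, A m →ₗ[ℝ] B m} {ψ : ∀ m, B m →ₗ[ℝ] C m}
    (hψ : IsAlgebroidHom ℬ 𝒞 ψ) (hφ : IsAlgebroidHom 𝒜 ℬ φ) :
    IsAlgebroidHom 𝒜 𝒞 (fun m => (ψ m).comp (φ m)) where
  map_sections s hs := hψ.map_sections _ (hφ.map_sections s hs)
  map_anchor m a := (hψ.map_anchor m (φ m a)).trans (hφ.map_anchor m a)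
  map_bracket s t m := (congrArg (ψ m) (hφ.map_bracket s t m)).trans
    (hψ.map_bracket (hφ.mapSections s) (hφ.mapSections t) m)

lemma isAlgebroidIso {φ : ∀ m, A m ≃ₗ[ℝ] B m}
    (h : IsAlgebroidHom 𝒜 ℬ (fun m => (φ m).toLinearMap))
    (hs : ∀ s ∈ ℬ.sections, (fun m => (φ m).symm (s m)) ∈ 𝒜.sections) :
    IsAlgebroidIso 𝒜 ℬ φ := by
  refine ⟨h, ⟨hs, fun m b => ?_, fun s t m => ?_⟩⟩
  · simpa using (h.map_anchor m ((φ m).symm b)).symm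
  · have hb := h.map_bracket ⟨_, hs s.1 s.2⟩ ⟨_, hs t.1 t.2⟩ m
    simp only [LinearEquiv.coe_coe, LinearEquiv.apply_symm_apply] at hb
    exact (LinearEquiv.symm_apply_eq _).2 hb.symm

lemma isLieAlgebroid_of_injective [IsManifold 𝓘(ℝ, E) ∞ M] {F F' : Type*}
    [NormedAddCommGroup F] [NormedSpace ℝ F] [NormedAddCommGroup F'] [NormedSpace ℝ F']
    {φ : ∀ m, A m →ₗ[ℝ] B m} (h : IsAlgebroidHom 𝒜 ℬ φ) (hφ : ∀ m, Function.Injective (φ m))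
    (hℬ : IsLieAlgebroid F' ℬ) (h𝒜 : IsSmoothVectorBundle E F 𝒜.sections) :
    IsLieAlgebroid F 𝒜 where
  smoothBundle := h𝒜
  anchor_smooth s hs := by
    simpa only [h.map_anchor] using hℬ.anchor_smooth _ (h.map_sections s hs)
  bracket_add s t t' := h.mapSections_injective hφ <| by
    simp only [map_add, mapSections_bracket, hℬ.bracket_add]
  bracket_smul c s t := h.mapSections_injective hφ <| by
    simp only [map_smul, mapSections_bracket, hℬ.bracket_smul]
  bracket_skew s t := h.mapSections_injective hφ <| by
    rw [map_neg, mapSections_bracket, mapSections_bracket, hℬ.bracket_skew]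
  jacobi s t r := h.mapSections_injective hφ <| by
    simp only [map_add, mapSections_bracket]
    exact hℬ.jacobi _ _ _
  leibniz f s t ft hft m := hφ m <| by
    have hleibniz := hℬ.leibniz f (h.mapSections s) (h.mapSections t) (h.mapSections ft)
      (fun p => (congrArg (φ p) (hft p)).trans (map_smul _ _ _)) m
    simp only [← mapSections_bracket] at hleibniz
    rw [← h.map_anchor, map_add, map_smul, map_smul]
    exact hleibniz
  anchor_bracket s t m := by
    have hanchor := hℬ.anchor_bracket (h.mapSections s) (h.mapSections t) m
    rw [← mapSections_bracket] at hanchor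
    simpa only [mapSections, LinearMap.coe_mk, AddHom.coe_mk, h.map_anchor] using hanchor

end IsAlgebroidHom

lemma IsLieAlgebroid.isAlgebroidHom_anchor [FiniteDimensional ℝ E] [IsManifold 𝓘(ℝ, E) ∞ M]
    {F : Type*} [NormedAddCommGroup F] [NormedSpace ℝ F] (h : IsLieAlgebroid F 𝒜) :
    IsAlgebroidHom 𝒜 (tangentAlgebroid E M) 𝒜.anchor where
  map_sections := h.anchor_smooth
  map_anchor _ _ := rfl
  map_bracket := h.anchor_bracket

end Morphisms

section ShortExact

variable {M : Type*} {A A' B B' C : M → Type*}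
  [∀ m, AddCommGroup (A m)] [∀ m, Module ℝ (A m)]
  [∀ m, AddCommGroup (A' m)] [∀ m, Module ℝ (A' m)]
  [∀ m, AddCommGroup (B m)] [∀ m, Module ℝ (B m)]
  [∀ m, AddCommGroup (B' m)] [∀ m, Module ℝ (B' m)]
  [∀ m, AddCommGroup (C m)] [∀ m, Module ℝ (C m)]

lemma IsShortExact.of_ladder {i : ∀ m, A m →ₗ[ℝ] B m} {p : ∀ m, B m →ₗ[ℝ] C m}
    {i' : ∀ m, A' m →ₗ[ℝ] B' m} {p' : ∀ m, B' m →ₗ[ℝ] C m} (h : IsShortExact i p)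
    (eA : ∀ m, A' m ≃ₗ[ℝ] A m) (eB : ∀ m, B' m ≃ₗ[ℝ] B m)
    (hi : ∀ m a, eB m (i' m a) = i m (eA m a)) (hp : ∀ m b, p m (eB m b) = p' m b) :
    IsShortExact i' p' := by
  intro m
  obtain ⟨hinj, hexact, hsurj⟩ := h m
  refine ⟨?_, ?_, ?_⟩
  · have hcomp : Function.Injective (eB m ∘ i' m) := by
      rw [show eB m ∘ i' m = i m ∘ eA m from funext (hi m)]
      exact hinj.comp (eA m).injective
    exact hcomp.of_comp
  · refine (Function.Exact.iff_of_ladder_linearEquiv (e₁ := eA m) (e₂ := eB m)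
      (e₃ := LinearEquiv.refl ℝ (C m)) ?_ ?_).1 hexact
    · exact LinearMap.ext fun a => (hi m a).symm
    · exact LinearMap.ext (hp m)
  · have hcomp : Function.Surjective (p m ∘ eB m) := hsurj.comp (eB m).surjective
    rwa [show p m ∘ eB m = p' m from funext (hp m)] at hcomp

end ShortExact

section LocalFrames

variable {E : Type*} [NormedAddCommGroup E] [NormedSpace ℝ E]
  {M : Type*} [TopologicalSpace M] [ChartedSpace E M]
  {A : M → Type*} [∀ m, AddCommGroup (A m)] [∀ m, Module ℝ (A m)]
  {κ : Type*} [Fintype κ] [DecidableEq κ]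

variable (E κ) in
/-- Local frames for a space `Γ` of sections of a family `A` of vector spaces: around each point
there are global elements of `Γ` forming a frame over an open set, in the coordinates of which `Γ`
is the space of smooth sections. This is what makes `A` a smooth vector bundle with `Γ` as its
sections. -/
structure LocalFrames (Γ : Submodule ℝ (∀ m, A m)) where
  /-- the domain of the frame at `x` -/
  dom : M → Set M
  isOpen_dom : ∀ x, IsOpen (dom x)
  mem_dom : ∀ x, x ∈ dom x
  /-- the frame at `x` -/
  frame : M → κ → Γ
  /-- the coordinates with respect to the frame at `x` -/
  coord : M → κ → ∀ p, A p →ₗ[ℝ] ℝ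
  sum_coord_smul_frame : ∀ x, ∀ p ∈ dom x, ∀ a, ∑ k, coord x k p a • (frame x k).1 p = a
  coord_frame : ∀ x, ∀ p ∈ dom x, ∀ k l, coord x k p ((frame x l).1 p) = if k = l then 1 else 0
  contMDiffOn_coord : ∀ s ∈ Γ, ∀ x k,
    ContMDiffOn 𝓘(ℝ, E) 𝓘(ℝ, ℝ) ∞ (fun p => coord x k p (s p)) (dom x)
  mem_of_contMDiffAt : ∀ s : ∀ p, A p,
    (∀ x k, ContMDiffAt 𝓘(ℝ, E) 𝓘(ℝ, ℝ) ∞ (fun p => coord x k p (s p)) x) → s ∈ Γ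

namespace LocalFrames

variable {Γ : Submodule ℝ (∀ m, A m)} {F : Type*} [NormedAddCommGroup F] [NormedSpace ℝ F]

section Coordinates

variable (L : LocalFrames E κ Γ) (b : Module.Basis κ ℝ F) (x p : M)

/-- The coordinates of a local frame, assembled to a map to a model space with basis `b`. -/
def toModel : A p →ₗ[ℝ] F :=
  b.equivFun.symm.toLinearMap.comp (LinearMap.pi fun k => L.coord x k p)

/-- The linear combination of a local frame with coefficients the coordinates in the basis `b`. -/
def ofModel : F →ₗ[ℝ] A p := b.constr ℝ fun k => (L.frame x k).1 p

lemma toModel_apply (a : A p) : L.toModel b x p a = ∑ k, L.coord x k p a • b k :=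
  b.equivFun_symm_apply _

lemma ofModel_apply (v : F) : L.ofModel b x p v = ∑ k, b.repr v k • (L.frame x k).1 p :=
  b.constr_apply_fintype ℝ _ v

variable {x p}

lemma ofModel_toModel (hp : p ∈ L.dom x) (a : A p) : L.ofModel b x p (L.toModel b x p a) = a := by
  rw [toModel_apply, ofModel_apply]
  simpa only [b.repr_sum_self] using L.sum_coord_smul_frame x p hp a

lemma toModel_ofModel (hp : p ∈ L.dom x) (v : F) : L.toModel b x p (L.ofModel b x p v) = v := by
  rw [ofModel_apply, toModel_apply]
  conv_rhs => rw [← b.sum_repr v]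
  refine Finset.sum_congr rfl fun k _ => ?_
  simp [L.coord_frame x p hp]

variable (x)

lemma contMDiffOn_toModel {s : ∀ m, A m} (hs : s ∈ Γ) :
    ContMDiffOn 𝓘(ℝ, E) 𝓘(ℝ, F) ∞ (fun p => L.toModel b x p (s p)) (L.dom x) := by
  simp only [toModel_apply]
  exact contMDiffOn_finsetSum fun k _ => (L.contMDiffOn_coord s hs x k).smul contMDiffOn_const

lemma mem_of_contMDiffAt_toModel {s : ∀ m, A m}
    (hs : ∀ x, ContMDiffAt 𝓘(ℝ, E) 𝓘(ℝ, F) ∞ (fun p => L.toModel b x p (s p)) x) : s ∈ Γ := by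
  have : FiniteDimensional ℝ F := .of_basis b
  refine L.mem_of_contMDiffAt s fun x k => ?_
  have hcoord := (b.coord k).toContinuousLinearMap.contMDiff.contMDiffAt.comp x (hs x)
  refine hcoord.congr_of_eventuallyEq (Filter.Eventually.of_forall fun p => ?_)
  simp only [Function.comp_apply, toModel_apply, LinearMap.coe_toContinuousLinearMap',
    Module.Basis.coord_apply, b.repr_sum_self]

/-- The local trivialization given by a local frame. -/
def pretriv : Pretrivialization F (TotalSpace.proj (F := F) (E := A)) where
  toFun a := (a.1, L.toModel b x a.1 a.2)
  invFun y := ⟨y.1, L.ofModel b x y.1 y.2⟩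
  source := TotalSpace.proj ⁻¹' L.dom x
  target := L.dom x ×ˢ Set.univ
  map_source' _ ha := ⟨ha, trivial⟩
  map_target' _ hy := hy.1
  left_inv' := by
    rintro ⟨p, a⟩ ha
    exact congrArg (TotalSpace.mk p) (L.ofModel_toModel b ha a)
  right_inv' := by
    rintro ⟨p, v⟩ hy
    exact Prod.ext rfl (L.toModel_ofModel b hy.1 v)
  open_target := (L.isOpen_dom x).prod isOpen_univ
  baseSet := L.dom x
  open_baseSet := L.isOpen_dom x
  source_eq := rfl
  target_eq := rfl
  proj_toFun _ _ := rfl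

lemma exists_contMDiffOn_coordChange (y : M) :
    ∃ f : M → F →L[ℝ] F, ContMDiffOn 𝓘(ℝ, E) 𝓘(ℝ, F →L[ℝ] F) ∞ f (L.dom x ∩ L.dom y) ∧
      ∀ p ∈ L.dom x ∩ L.dom y, ∀ v, f p v = L.toModel b y p ((L.pretriv b x).symm p v) := by
  have : FiniteDimensional ℝ F := .of_basis b
  refine ⟨fun p => ∑ k, ContinuousLinearMap.smulRightL ℝ F F (b.coord k).toContinuousLinearMap
    (L.toModel b y p ((L.frame x k).1 p)), ?_, fun p hp v => ?_⟩
  · refine contMDiffOn_finsetSum fun k _ => contMDiffOn_const.clm_apply ?_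
    exact (L.contMDiffOn_toModel b y (L.frame x k).2).mono Set.inter_subset_right
  · rw [show (L.pretriv b x).symm p v = L.ofModel b x p v from (L.pretriv b x).symm_apply hp.1 v,
      ofModel_apply]
    simp

end Coordinates

/-- The atlas of vector bundle charts given by local frames. -/
def prebundle [∀ m, TopologicalSpace (A m)] (L : LocalFrames E κ Γ)
    (b : Module.Basis κ ℝ F) (h : ∀ m, Topology.IsInducing (L.toModel b m m)) :
    VectorPrebundle ℝ F A where
  pretrivializationAtlas := Set.range (L.pretriv b)
  pretrivialization_linear' := by
    rintro _ ⟨x, rfl⟩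
    exact ⟨fun p _ => (L.toModel b x p).isLinear⟩
  pretrivializationAt := L.pretriv b
  mem_base_pretrivializationAt := L.mem_dom
  pretrivialization_mem_atlas x := ⟨x, rfl⟩
  exists_coordChange := by
    rintro _ ⟨x, rfl⟩ _ ⟨y, rfl⟩
    obtain ⟨f, hf, hf'⟩ := L.exists_contMDiffOn_coordChange b x y
    exact ⟨f, hf.continuousOn, hf'⟩
  totalSpaceMk_isInducing m := (isEmbedding_prodMkRight m).isInducing.comp (h m)

theorem isSmoothVectorBundle [IsManifold 𝓘(ℝ, E) ∞ M]
    (L : LocalFrames E κ Γ) (b : Module.Basis κ ℝ F) : IsSmoothVectorBundle E F Γ := by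
  let (m : M) : TopologicalSpace (A m) := TopologicalSpace.induced (L.toModel b m m) inferInstance
  let a := L.prebundle b fun m => ⟨rfl⟩
  have : a.IsContMDiff 𝓘(ℝ, E) ∞ := ⟨by
    rintro _ ⟨x, rfl⟩ _ ⟨y, rfl⟩
    exact L.exists_contMDiffOn_coordChange b x y⟩
  let := a.totalSpaceTopology
  let := a.toFiberBundle
  let := a.toVectorBundle
  refine ⟨_, _, a.toFiberBundle, a.toVectorBundle, a.contMDiffVectorBundle 𝓘(ℝ, E), fun s => ?_⟩
  have contMDiffAt_iff (x : M) : ContMDiffAt 𝓘(ℝ, E) (𝓘(ℝ, E).prod 𝓘(ℝ, F)) ∞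
      (fun m => TotalSpace.mk' F m (s m)) x ↔
      ContMDiffAt 𝓘(ℝ, E) 𝓘(ℝ, F) ∞ (fun p => L.toModel b x p (s p)) x := contMDiffAt_section x
  constructor
  · exact fun hs x => (contMDiffAt_iff x).2 <|
      (L.contMDiffOn_toModel b x hs).contMDiffAt ((L.isOpen_dom x).mem_nhds (L.mem_dom x))
  · exact fun hs => L.mem_of_contMDiffAt_toModel b fun x => (contMDiffAt_iff x).1 (hs x)

/-- Transport of local frames along a fibrewise isomorphism matching the sections. -/
def congr {B : M → Type*} [∀ m, AddCommGroup (B m)] [∀ m, Module ℝ (B m)]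
    {Δ : Submodule ℝ (∀ m, B m)} (L : LocalFrames E κ Γ) (φ : ∀ m, B m ≃ₗ[ℝ] A m)
    (h : ∀ s, s ∈ Δ ↔ (fun m => φ m (s m)) ∈ Γ) : LocalFrames E κ Δ where
  dom := L.dom
  isOpen_dom := L.isOpen_dom
  mem_dom := L.mem_dom
  frame x k := ⟨fun p => (φ p).symm ((L.frame x k).1 p), by simp [h]⟩
  coord x k p := (L.coord x k p).comp (φ p).toLinearMap
  sum_coord_smul_frame x p hp a := (φ p).injective <| by
    simpa using L.sum_coord_smul_frame x p hp (φ p a)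
  coord_frame x p hp k l := by simp [L.coord_frame x p hp]
  contMDiffOn_coord s hs := L.contMDiffOn_coord _ ((h s).1 hs)
  mem_of_contMDiffAt s hs := (h s).2 (L.mem_of_contMDiffAt _ hs)

end LocalFrames

end LocalFrames

section FieldBracket

variable {E : Type*} [NormedAddCommGroup E] [NormedSpace ℝ E] [FiniteDimensional ℝ E]
  {M : Type*} [TopologicalSpace M] [ChartedSpace E M] [IsManifold 𝓘(ℝ, E) ∞ M]

lemma vbracket_zero_right (u : VField E M) : vbracket u 0 = 0 := by
  simpa using vbracket_smul_right u 0 0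

lemma vbracket_neg_right (u v : VField E M) : vbracket u (-v) = -vbracket u v := by
  simpa using vbracket_smul_right u (-1) v

end FieldBracket

section Atiyah

variable {E : Type*} [NormedAddCommGroup E] [NormedSpace ℝ E]
  {M : Type*} [TopologicalSpace M] [ChartedSpace E M] [IsManifold 𝓘(ℝ, E) ∞ M]

lemma gact_map_zero (d : GaugeSec E M) : gact d 0 = 0 :=
  ContMDiffSection.ext fun m => map_zero (gaugeOp m (d.1 m))

lemma gact_map_neg (d : GaugeSec E M) (u : VField E M) : gact d (-u) = -gact d u :=
  ContMDiffSection.ext fun m => map_neg (gaugeOp m (d.1 m)) u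

lemma gaugeOp_gaugeEmbed (m : M) (Φ : Tang E m →L[ℝ] Tang E m) (u : VField E M) :
    gaugeOp m (gaugeEmbed m Φ) u = Φ (u m) := rfl

@[simp] lemma gaugeAnchor_gaugeEmbed (m : M) (Φ : Tang E m →L[ℝ] Tang E m) :
    gaugeAnchor m (gaugeEmbed m Φ) = 0 := rfl

/-- The section `ξ ⊗ w` of `𝔤𝔩(TM)`, as a section of the gauge algebroid. -/
def rankOne (ξ : OneForm E M) (w : VField E M) : GaugeSec E M :=
  ⟨fun m => gaugeEmbed m ((ξ m : Tang E m →L[ℝ] ℝ).smulRight (w m)),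
    fun u => (fsmul (contract ξ u) w).contMDiff, (0 : VField E M).contMDiff⟩

lemma gaugeOp_rankOne (ξ : OneForm E M) (w u : VField E M) (m : M) :
    gaugeOp m ((rankOne ξ w).1 m) u = ξ m (u m) • w m := rfl

@[simp] lemma gaugeAnchor_rankOne (ξ : OneForm E M) (w : VField E M) (m : M) :
    gaugeAnchor m ((rankOne ξ w).1 m) = 0 := rfl

variable [FiniteDimensional ℝ E] [T2Space M]

/-- A linear choice of smooth vector fields with prescribed value at `m`. -/
def extendVec (m : M) : Tang E m →ₗ[ℝ] VField E M := (tbasis E m).constr ℝ (frame m)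

@[simp] lemma extendVec_self (m : M) (x : Tang E m) : extendVec m x m = x := by
  rw [extendVec, Module.Basis.constr_apply_fintype, field_sum_apply]
  calc ∑ i, (tbasis E m).equivFun x i • frame m i m
      = ∑ i, (tbasis E m).equivFun x i • tbasis E m i := by simp only [frame_self]
    _ = x := (tbasis E m).sum_equivFun x

lemma gaugeEmbed_injective (m : M) : Function.Injective (gaugeEmbed (E := E) m) := by
  intro Φ Ψ h
  ext x
  have happly := congrArg (fun d => gaugeOp m d (extendVec m x)) h
  simpa only [gaugeOp_gaugeEmbed, extendVec_self] using happly

lemma exact_gaugeEmbed_gaugeAnchor (m : M) :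
    Function.Exact (gaugeEmbed (E := E) m) (gaugeAnchor m) := by
  refine fun d => ⟨fun hd => ?_, fun ⟨Φ, hΦ⟩ => hΦ ▸ gaugeAnchor_gaugeEmbed m Φ⟩
  have : FiniteDimensional ℝ (Tang E m) := ‹FiniteDimensional ℝ E›
  have : T2Space (Tang E m) := inferInstanceAs (T2Space E)
  refine ⟨((gaugeOp m d).comp (extendVec m)).toContinuousLinearMap, gauge_ext (fun u => ?_) hd.symm⟩
  have htensorial : gaugeOp m d (extendVec m (u m) - u) = 0 :=
    gaugeOp_eq_zero_of_anchor d hd <| by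
      simp only [ContMDiffSection.coe_sub, Pi.sub_apply, extendVec_self, sub_self]
  rwa [map_sub, sub_eq_zero] at htensorial

lemma isShortExact_gauge : IsShortExact (gaugeEmbed (E := E) (M := M)) gaugeAnchor := fun m =>
  ⟨gaugeEmbed_injective m, exact_gaugeEmbed_gaugeAnchor m, fun x =>
    ⟨adAt m (extendVec m x), extendVec_self m x⟩⟩

lemma exists_eq_adAt_add_gaugeEmbed {m : M} {d : Gauge E m} {X : VField E M}
    (hX : X m = gaugeAnchor m d) : ∃ Φ, d = adAt m X + gaugeEmbed m Φ := by
  have hanchor : gaugeAnchor m (d - adAt m X) = 0 := by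
    rw [map_sub, gaugeAnchor_adAt, hX, sub_self]
  obtain ⟨Φ, hΦ⟩ := (exact_gaugeEmbed_gaugeAnchor m _).1 hanchor
  exact ⟨Φ, by rw [hΦ, add_sub_cancel]⟩

end Atiyah

section JetIsomorphism

variable {E : Type*} [NormedAddCommGroup E] [NormedSpace ℝ E] [FiniteDimensional ℝ E]
  {M : Type*} [TopologicalSpace M] [ChartedSpace E M] [IsManifold 𝓘(ℝ, E) ∞ M] [T2Space M]

/-- The difference of the two sides is the value on `u` of the bracket of `ad X` with `ξ ⊗ w`,
an operator with zero anchor. -/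
lemma mvfderiv_contract_smul_of_apply_eq_zero (ξ : OneForm E M) {u : VField E M} (X w : VField E M)
    {m : M} (hu : u m = 0) :
    mvfderiv 𝓘(ℝ, E) (contract ξ u) m (X m) • w m = ξ m (vbracket X u m) • w m := by
  set d := gaugeBracket (ad X) (rankOne ξ w)
  have hanchor : gaugeAnchor m (d.1 m) = 0 := congrArg (fun v : VField E M => v m)
    (vbracket_zero_right X)
  have hvalue : gaugeOp m (d.1 m) u = contract ξ u m • vbracket X w m
      + mvfderiv 𝓘(ℝ, E) (contract ξ u) m (X m) • w m - ξ m (vbracket X u m) • w m :=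
    congrArg (fun v : VField E M => v m - ξ m (vbracket X u m) • w m)
      (vbracket_fsmul_right X w (contract ξ u))
  have hzero := gaugeOp_eq_zero_of_anchor _ hanchor hu
  rwa [hvalue, contract_apply, hu, map_zero, zero_smul, zero_add, sub_eq_zero] at hzero

lemma ker_adAt_le_jetNull (m : M) : LinearMap.ker (adAt m) ≤ jetNull (E := E) m := by
  intro u hu
  have hum : u m = 0 := congrArg (gaugeAnchor m) hu
  refine ⟨hum, fun ξ => ContinuousLinearMap.ext fun x => ?_⟩
  set X := extendVec m x
  have hbracket : vbracket X u m = 0 := by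
    rw [vbracket_swap]
    exact neg_eq_zero.2 (congrArg (fun d => gaugeOp m d X) hu)
  have hsmul := mvfderiv_contract_smul_of_apply_eq_zero ξ X X hum
  rw [hbracket, map_zero, zero_smul, extendVec_self, smul_eq_zero] at hsmul
  rcases hsmul with h | rfl
  · exact h
  · exact map_zero _

lemma jetToGauge_injective (m : M) : Function.Injective (jetToGauge (E := E) m) :=
  LinearMap.ker_eq_bot.1 <| Submodule.ker_liftQ_eq_bot _ _ _ (ker_adAt_le_jetNull m)

lemma jetToGauge_jetEmbed (m : M) (y : Tang E m →L[ℝ] Tang E m) :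
    jetToGauge m (jetEmbed m y) = gaugeEmbed m (-y) := by
  refine gauge_ext (fun u => ?_) ?_
  · rw [gaugeOp_jetToGauge, pairing_jetEmbed, gaugeAnchor_adAt, gaugeOp_gaugeEmbed]
    rfl
  · rw [gaugeAnchor_jetToGauge, gaugeAnchor_gaugeEmbed]
    have hid := pairing_gaugeEmbed m (jetEmbed m y) (ContinuousLinearMap.id ℝ _)
    rw [pairing_jetEmbed, gaugeAnchor_gaugeEmbed, map_zero] at hid
    exact hid.symm

lemma jetToGauge_surjective (m : M) : Function.Surjective (jetToGauge (E := E) m) := by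
  intro d
  obtain ⟨Φ, hΦ⟩ := exists_eq_adAt_add_gaugeEmbed (extendVec_self m (gaugeAnchor m d))
  exact ⟨jet m (extendVec m (gaugeAnchor m d)) + jetEmbed m (-Φ), by
    rw [map_add, jetToGauge_jet, jetToGauge_jetEmbed, neg_neg, ← hΦ]⟩

/-- The canonical isomorphism `𝔍(TM)_m ≃ 𝔇(TM)_m`, `[u]_m ↦ [u, ·](m)`. -/
def jetEquivGauge (m : M) : Jet E m ≃ₗ[ℝ] Gauge E m :=
  LinearEquiv.ofBijective (jetToGauge m) ⟨jetToGauge_injective m, jetToGauge_surjective m⟩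

lemma isShortExact_jet : IsShortExact (jetEmbed (E := E) (M := M)) jetProj :=
  isShortExact_gauge.of_ladder (fun _ => LinearEquiv.neg ℝ) jetEquivGauge jetToGauge_jetEmbed
    gaugeAnchor_jetToGauge

end JetIsomorphism

section JetBracket

variable {E : Type*} [NormedAddCommGroup E] [NormedSpace ℝ E] [FiniteDimensional ℝ E]
  {M : Type*} [TopologicalSpace M] [ChartedSpace E M] [IsManifold 𝓘(ℝ, E) ∞ M] [T2Space M]

lemma pairing_eq_of_apply_eq {m : M} {μ : Jet E m} {d : Gauge E m} {X w : VField E M}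
    (hX : X m = gaugeAnchor m d) (hw : w m = jetProj m μ) :
    pairing m μ d = gaugeOp m d w - gaugeOp m (jetToGauge m μ) X - vbracket X w m := by
  obtain ⟨Φ, rfl⟩ := exists_eq_adAt_add_gaugeEmbed hX
  simp only [map_add, LinearMap.add_apply, pairing_gaugeEmbed, gaugeOp_adAt, gaugeOp_gaugeEmbed,
    gaugeOp_jetToGauge, hw]
  abel

lemma pairSec_eq (μ : JetSec E M) (d : GaugeSec E M) :
    pairSec μ d = gact d (ganchor (jetPi μ)) - gact (jetPi μ) (ganchor d)
      - vbracket (ganchor d) (ganchor (jetPi μ)) :=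
  ContMDiffSection.ext fun m => pairing_eq_of_apply_eq rfl (gaugeAnchor_jetToGauge m (μ.1 m))

lemma mem_jetSections_iff (μ : ∀ m : M, Jet E m) :
    μ ∈ jetSections (E := E) (M := M) ↔
      (fun m => jetEquivGauge m (μ m)) ∈ gaugeSections (E := E) (M := M) := by
  refine ⟨fun h => (jetPi ⟨μ, h⟩).2, fun h d => ?_⟩
  set D : GaugeSec E M := ⟨_, h⟩
  refine (gact d (ganchor D) - gact D (ganchor d)
    - vbracket (ganchor d) (ganchor D)).contMDiff.congr fun m => congrArg (TotalSpace.mk m) ?_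
  exact pairing_eq_of_apply_eq rfl (gaugeAnchor_jetToGauge m (μ m))

lemma pairSec_jetBracket (μ ν : JetSec E M) (d : GaugeSec E M) :
    pairSec (jetBracket μ ν) d = gact d (vbracket (ganchor (jetPi μ)) (ganchor (jetPi ν)))
      - gact (gaugeBracket (jetPi μ) (jetPi ν)) (ganchor d)
      - vbracket (ganchor d) (vbracket (ganchor (jetPi μ)) (ganchor (jetPi ν))) := by
  have hsub (κ κ' : JetSec E M) : pairSec (κ - κ') d = pairSec κ d - pairSec κ' d := by
    ext m
    simp [pairSec_apply]
  rw [jetBracket, hsub, hsub, pairSec_lieDeriv, pairSec_lieDeriv, pairSec_prolong]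
  simp only [pairSec_eq, gact_gaugeBracket, ganchor_gaugeBracket, gact_map_sub]
  set X := ganchor (jetPi μ)
  set Y := ganchor (jetPi ν)
  set Z := ganchor d
  have hjacobi : vbracket (vbracket X Z) Y =
      vbracket (vbracket Y Z) X - vbracket Z (vbracket X Y) := by
    rw [vbracket_swap (vbracket Y Z) X, vbracket_swap Y Z, vbracket_neg_right, neg_neg,
      vbracket_jacobi X Z Y, add_sub_cancel_right]
  rw [hjacobi, vbracket_swap X Z, vbracket_swap Y Z, gact_map_neg, gact_map_neg]
  abel

lemma jetPi_jetBracket (μ ν : JetSec E M) :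
    jetPi (jetBracket μ ν) = gaugeBracket (jetPi μ) (jetPi ν) := by
  refine gsec_ext (fun v => ?_) ?_
  · calc gact (jetPi (jetBracket μ ν)) v = -pairSec (jetBracket μ ν) (ad v) :=
          ContMDiffSection.ext fun m => gaugeOp_jetToGauge m _ v
      _ = gact (gaugeBracket (jetPi μ) (jetPi ν)) v := by
          rw [pairSec_jetBracket, ganchor_ad, gact_ad]
          abel
  · calc ganchor (jetPi (jetBracket μ ν)) = pairSec (jetBracket μ ν) gaugeOne :=
          ContMDiffSection.ext fun m => (gaugeAnchor_jetToGauge m _).trans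
            (pairing_gaugeEmbed m _ (ContinuousLinearMap.id ℝ _)).symm
      _ = ganchor (gaugeBracket (jetPi μ) (jetPi ν)) := by
          have hanchor : ganchor (gaugeOne : GaugeSec E M) = 0 := rfl
          rw [pairSec_jetBracket, hanchor, vbracket_swap 0, vbracket_zero_right, gact_map_zero,
            neg_zero, sub_zero, sub_zero]
          rfl

end JetBracket

section GaugeFrames

variable {E : Type*} [NormedAddCommGroup E] [NormedSpace ℝ E] [FiniteDimensional ℝ E]
  {M : Type*} [TopologicalSpace M] [ChartedSpace E M] [IsManifold 𝓘(ℝ, E) ∞ M] [T2Space M]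

variable (E) in
/-- An open neighbourhood of `x` over which `frame x` and `coframe x`, being cut off by the bump
function at `x`, are dual frames. -/
def frameDom (x : M) : Set M := interior {p | bumpFn E x p = 1}

lemma mem_frameDom (x : M) : x ∈ frameDom E x :=
  mem_interior_iff_mem_nhds.2 (bump E x).eventuallyEq_one

lemma bumpFn_of_mem_frameDom {x p : M} (hp : p ∈ frameDom E x) : bumpFn E x p = 1 :=
  interior_subset (s := {p | bumpFn E x p = 1}) hp

lemma sum_coframe_smul_frame {x p : M} (hp : p ∈ frameDom E x) (v : Tang E p) :
    ∑ i, coframe x i p v • frame x i p = v := by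
  rw [sum_coframe, bumpFn_of_mem_frameDom hp, one_mul, one_smul]

lemma coframe_frame {x p : M} (hp : p ∈ frameDom E x) (i j : Fin (Module.finrank ℝ E)) :
    coframe x i p (frame x j p) = if i = j then 1 else 0 := by
  have hb : p ∈ (triv E x).baseSet := by
    by_contra h
    exact one_ne_zero ((bumpFn_of_mem_frameDom hp).symm.trans (bumpFn_eq_zero h))
  rw [coframe_apply, frame_apply, bumpFn_of_mem_frameDom hp, one_smul, one_mul,
    ← (triv E x).symmL_apply (R := ℝ) hb, Trivialization.continuousLinearMapAt_symmL _ hb,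
    Module.Basis.repr_self, Finsupp.single_apply]
  simp only [eq_comm]

lemma gauge_ext_frame {x p : M} (hp : p ∈ frameDom E x) {d d' : Gauge E p}
    (hop : ∀ i, gaugeOp p d (frame x i) = gaugeOp p d' (frame x i))
    (hanchor : gaugeAnchor p d = gaugeAnchor p d') : d = d' := by
  have hzero : gaugeAnchor p (d - d') = 0 := by rw [map_sub, hanchor, sub_self]
  obtain ⟨Φ, hΦ⟩ := (exact_gaugeEmbed_gaugeAnchor p _).1 hzero
  have hframe (i : Fin (Module.finrank ℝ E)) : Φ (frame x i p) = 0 := by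
    rw [← gaugeOp_gaugeEmbed, hΦ, map_sub, LinearMap.sub_apply, hop, sub_self]
  have hΦ_zero : Φ = 0 := by
    ext v
    rw [← sum_coframe_smul_frame hp v, map_sum]
    simp only [map_smul, hframe, smul_zero, Finset.sum_const_zero]
    rfl
  rw [← sub_eq_zero, ← hΦ, hΦ_zero, map_zero]

/-- A section of the gauge algebroid lifting `frame x k`, normalized to annihilate `frame x i`
for all `i` near `x`. -/
def gaugeLift (x : M) (k : Fin (Module.finrank ℝ E)) : GaugeSec E M :=
  ad (frame x k) - ∑ i, rankOne (coframe x i) (vbracket (frame x k) (frame x i))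

lemma gaugeOp_gaugeLift (x p : M) (k : Fin (Module.finrank ℝ E)) (u : VField E M) :
    gaugeOp p ((gaugeLift x k).1 p) u = vbracket (frame x k) u p
      - ∑ i, coframe x i p (u p) • vbracket (frame x k) (frame x i) p := by
  simp [gaugeLift, gaugeOp_adAt, ad_apply, gaugeOp_rankOne]

lemma gaugeOp_gaugeLift_frame {x p : M} (hp : p ∈ frameDom E x)
    (k i : Fin (Module.finrank ℝ E)) : gaugeOp p ((gaugeLift x k).1 p) (frame x i) = 0 := by
  simp [gaugeOp_gaugeLift, coframe_frame hp]

lemma gaugeAnchor_gaugeLift (x p : M) (k : Fin (Module.finrank ℝ E)) :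
    gaugeAnchor p ((gaugeLift x k).1 p) = frame x k p := by
  simp [gaugeLift, gaugeAnchor_adAt, ad_apply]

/-- The frame of the gauge algebroid induced by the frame `frame x` of `TM`. -/
def gaugeFrame (x : M) :
    Fin (Module.finrank ℝ E) ⊕ Fin (Module.finrank ℝ E) × Fin (Module.finrank ℝ E) → GaugeSec E M
  | .inl k => gaugeLift x k
  | .inr (i, j) => rankOne (coframe x i) (frame x j)

/-- The coordinates with respect to `gaugeFrame x`. -/
def gaugeCoord (x : M) :
    Fin (Module.finrank ℝ E) ⊕ Fin (Module.finrank ℝ E) × Fin (Module.finrank ℝ E) →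
      ∀ p : M, Gauge E p →ₗ[ℝ] ℝ
  | .inl k, p => (coframe x k p : Tang E p →L[ℝ] ℝ).toLinearMap.comp (gaugeAnchor p)
  | .inr (i, j), p =>
    (coframe x j p : Tang E p →L[ℝ] ℝ).toLinearMap.comp ((gaugeOp p).flip (frame x i))

lemma gaugeCoord_inl (x p : M) (k : Fin (Module.finrank ℝ E)) (d : Gauge E p) :
    gaugeCoord x (.inl k) p d = coframe x k p (gaugeAnchor p d) := rfl

lemma gaugeCoord_inr (x p : M) (i j : Fin (Module.finrank ℝ E)) (d : Gauge E p) :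
    gaugeCoord x (.inr (i, j)) p d = coframe x j p (gaugeOp p d (frame x i)) := rfl

lemma sum_gaugeCoord_smul_gaugeFrame {x p : M} (hp : p ∈ frameDom E x) (d : Gauge E p) :
    ∑ k, gaugeCoord x k p d • (gaugeFrame x k).1 p = d := by
  refine gauge_ext_frame hp (fun l => ?_) ?_
  · simp [Fintype.sum_prod_type, gaugeFrame, gaugeCoord_inr, gaugeOp_gaugeLift_frame hp,
      gaugeOp_rankOne, coframe_frame hp, sum_coframe_smul_frame hp]
  · simp [Fintype.sum_prod_type, gaugeFrame, gaugeCoord_inl, gaugeAnchor_gaugeLift,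
      sum_coframe_smul_frame hp]

lemma gaugeCoord_gaugeFrame {x p : M} (hp : p ∈ frameDom E x)
    (k l : Fin (Module.finrank ℝ E) ⊕ Fin (Module.finrank ℝ E) × Fin (Module.finrank ℝ E)) :
    gaugeCoord x k p ((gaugeFrame x l).1 p) = if k = l then 1 else 0 := by
  rcases k with k | ⟨i, j⟩ <;> rcases l with l | ⟨i', j'⟩
  · simp [gaugeFrame, gaugeCoord_inl, gaugeAnchor_gaugeLift, coframe_frame hp]
  · simp [gaugeFrame, gaugeCoord_inl]
  · simp [gaugeFrame, gaugeCoord_inr, gaugeOp_gaugeLift_frame hp]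
  · rw [gaugeFrame, gaugeCoord_inr, gaugeOp_rankOne, map_smul, coframe_frame hp, coframe_frame hp]
    by_cases hi : i = i' <;> simp [hi, @eq_comm _ i' i]

lemma contMDiff_gaugeCoord (x : M) (d : GaugeSec E M) :
    ∀ k, ContMDiff 𝓘(ℝ, E) 𝓘(ℝ, ℝ) ∞ (fun p => gaugeCoord x k p (d.1 p))
  | .inl k => (contract (coframe x k) (ganchor d)).contMDiff
  | .inr (i, j) => (contract (coframe x j) (gact d (frame x i))).contMDiff

lemma mem_gaugeSections_of_contMDiffAt {s : ∀ p : M, Gauge E p}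
    (hs : ∀ x k, ContMDiffAt 𝓘(ℝ, E) 𝓘(ℝ, ℝ) ∞ (fun p => gaugeCoord x k p (s p)) x) :
    s ∈ gaugeSections (E := E) (M := M) := by
  have hsum (x : M) : ∀ᶠ p in 𝓝 x, ∑ k, gaugeCoord x k p (s p) • (gaugeFrame x k).1 p = s p :=
    Filter.mem_of_superset (isOpen_interior.mem_nhds (mem_frameDom x)) fun p hp =>
      sum_gaugeCoord_smul_gaugeFrame hp (s p)
  refine ⟨fun u x => ?_, fun x => ?_⟩
  · refine (ContMDiffAt.sum_section (s := Finset.univ) fun k _ => (hs x k).smul_section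
      (gact (gaugeFrame x k) u).contMDiff.contMDiffAt).congr_of_eventuallyEq ?_
    filter_upwards [hsum x] with p hp
    conv_lhs => rw [← hp]
    simp [gact_apply]
  · refine (ContMDiffAt.sum_section (s := Finset.univ) fun k _ => (hs x k).smul_section
      (ganchor (gaugeFrame x k)).contMDiff.contMDiffAt).congr_of_eventuallyEq ?_
    filter_upwards [hsum x] with p hp
    conv_lhs => rw [← hp]
    simp [ganchor_apply]

variable (E M) in
/-- The local frames of the gauge algebroid of `TM` induced by local frames of `TM`. -/
def gaugeFrames : LocalFrames E
    (Fin (Module.finrank ℝ E) ⊕ Fin (Module.finrank ℝ E) × Fin (Module.finrank ℝ E))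
    (gaugeSections (E := E) (M := M)) where
  dom := frameDom E
  isOpen_dom _ := isOpen_interior
  mem_dom := mem_frameDom
  frame := gaugeFrame
  coord := gaugeCoord
  sum_coord_smul_frame _ _ := sum_gaugeCoord_smul_gaugeFrame
  coord_frame _ _ := gaugeCoord_gaugeFrame
  contMDiffOn_coord s hs x k := (contMDiff_gaugeCoord x ⟨s, hs⟩ k).contMDiffOn
  mem_of_contMDiffAt _ := mem_gaugeSections_of_contMDiffAt

variable (E) in
/-- A basis of the model fibre of `𝔇(TM)` and `𝔍(TM)`; which one is immaterial. -/
def gaugeModelBasis : Module.Basis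
    (Fin (Module.finrank ℝ E) ⊕ Fin (Module.finrank ℝ E) × Fin (Module.finrank ℝ E)) ℝ
    (E × (E →L[ℝ] E)) :=
  (Module.finBasis ℝ (E × (E →L[ℝ] E))).reindex <| Fintype.equivOfCardEq <| by
    have hhom : Module.finrank ℝ (E →L[ℝ] E) = Module.finrank ℝ E * Module.finrank ℝ E :=
      LinearMap.toContinuousLinearMap.finrank_eq.symm.trans (Module.finrank_linearMap ℝ ℝ E E)
    simp [hhom]

end GaugeFrames

section Algebroids

variable {E : Type*} [NormedAddCommGroup E] [NormedSpace ℝ E]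
  {M : Type*} [TopologicalSpace M] [ChartedSpace E M] [IsManifold 𝓘(ℝ, E) ∞ M]

lemma isSmoothVectorBundle_gl : IsSmoothVectorBundle E (E →L[ℝ] E) (glSections E M) :=
  ⟨_, _, inferInstance, inferInstance, inferInstance, fun _ => Iff.rfl⟩

variable [FiniteDimensional ℝ E]

lemma isLieAlgebroid_tangent : IsLieAlgebroid E (tangentAlgebroid E M) where
  smoothBundle := ⟨_, _, inferInstance, inferInstance, inferInstance, fun _ => Iff.rfl⟩
  anchor_smooth _ hs := hs
  bracket_add s t t' := Subtype.ext <| funext <| DFunLike.congr_fun <|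
    vbracket_add_right ⟨s.1, s.2⟩ ⟨t.1, t.2⟩ ⟨t'.1, t'.2⟩
  bracket_smul c s t := Subtype.ext <| funext <| DFunLike.congr_fun <|
    vbracket_smul_right ⟨s.1, s.2⟩ c ⟨t.1, t.2⟩
  bracket_skew s t := Subtype.ext <| funext <| DFunLike.congr_fun <|
    vbracket_swap ⟨s.1, s.2⟩ ⟨t.1, t.2⟩
  jacobi s t r := Subtype.ext <| funext <| DFunLike.congr_fun <|
    vbracket_jacobi ⟨s.1, s.2⟩ ⟨t.1, t.2⟩ ⟨r.1, r.2⟩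
  leibniz f s t ft h := by
    have hft : (⟨ft.1, ft.2⟩ : VField E M) = fsmul f ⟨t.1, t.2⟩ := ContMDiffSection.ext h
    exact DFunLike.congr_fun <| (congrArg (vbracket ⟨s.1, s.2⟩) hft).trans <|
      vbracket_fsmul_right ⟨s.1, s.2⟩ ⟨t.1, t.2⟩ f
  anchor_bracket _ _ _ := rfl

lemma isAlgebroidHom_gaugeEmbed :
    IsAlgebroidHom (glAlgebroid E M) (gaugeAlgebroid E M) gaugeEmbed where
  map_sections _ hy :=
    ⟨fun u => ContMDiff.clm_bundle_apply (IB := 𝓘(ℝ, E)) (F₂ := E) hy u.contMDiff,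
      (0 : VField E M).contMDiff⟩
  map_anchor _ _ := rfl
  map_bracket _ _ m := gauge_ext (fun _ => rfl)
    (DFunLike.congr_fun (vbracket_zero_right (0 : VField E M)) m).symm

lemma isAlgebroidHom_neg :
    IsAlgebroidHom (glOpAlgebroid E M) (glAlgebroid E M) (fun _ => -LinearMap.id) where
  map_sections _ hy := (glSections E M).neg_mem hy
  map_anchor _ _ := rfl
  map_bracket y z m := by
    ext v
    simp [glOpAlgebroid, glAlgebroid]

variable [T2Space M]

lemma gaugeBracket_add_right (s t t' : GaugeSec E M) :
    gaugeBracket s (t + t') = gaugeBracket s t + gaugeBracket s t' := by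
  refine gsec_ext (fun u => ?_) ?_
  · simp only [gact_gaugeBracket, gact_add, gact_map_add]
    abel
  · simp only [ganchor_gaugeBracket, ganchor_add, vbracket_add_right]

lemma gaugeBracket_smul_right (c : ℝ) (s t : GaugeSec E M) :
    gaugeBracket s (c • t) = c • gaugeBracket s t := by
  refine gsec_ext (fun u => ContMDiffSection.ext fun m => ?_) ?_
  · change gaugeOp m (s.1 m) (c • gact t u) - c • gaugeOp m (t.1 m) (gact s u) =
      c • (gaugeOp m (s.1 m) (gact t u) - gaugeOp m (t.1 m) (gact s u))
    rw [map_smul, smul_sub]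
  · exact vbracket_smul_right (ganchor s) c (ganchor t)

lemma gaugeBracket_swap (s t : GaugeSec E M) : gaugeBracket s t = -gaugeBracket t s := by
  refine gsec_ext (fun u => ?_) ?_
  · exact (neg_sub (gact t (gact s u)) (gact s (gact t u))).symm
  · exact vbracket_swap (ganchor s) (ganchor t)

lemma gaugeBracket_jacobi (s t r : GaugeSec E M) :
    gaugeBracket s (gaugeBracket t r) =
      gaugeBracket (gaugeBracket s t) r + gaugeBracket t (gaugeBracket s r) := by
  refine gsec_ext (fun u => ?_) ?_
  · simp only [gact_gaugeBracket, gact_add, gact_map_sub]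
    abel
  · exact vbracket_jacobi (ganchor s) (ganchor t) (ganchor r)

lemma gaugeBracket_gsmul_right (f : SmoothFn E M) (s t : GaugeSec E M) :
    gaugeBracket s (gsmul f t) = gsmul f (gaugeBracket s t) + gsmul (dir (ganchor s) f) t := by
  refine gsec_ext (fun u => ?_) ?_
  · simp only [gact_gaugeBracket, gact_add, gact_gsmul, gact_fsmul]
    ext m
    simp only [fsmul_apply, ContMDiffSection.coe_sub, ContMDiffSection.coe_add, Pi.sub_apply,
      Pi.add_apply, smul_sub]
    abel
  · simp only [ganchor_gaugeBracket, ganchor_add, ganchor_gsmul, vbracket_fsmul_right]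

lemma isLieAlgebroid_gauge : IsLieAlgebroid (E × (E →L[ℝ] E)) (gaugeAlgebroid E M) where
  smoothBundle := (gaugeFrames E M).isSmoothVectorBundle (gaugeModelBasis E)
  anchor_smooth _ hs := hs.2
  bracket_add := gaugeBracket_add_right
  bracket_smul := gaugeBracket_smul_right
  bracket_skew := gaugeBracket_swap
  jacobi := gaugeBracket_jacobi
  leibniz f s t ft h m := by
    obtain rfl : ft = gsmul f t := Subtype.ext (funext h)
    exact congrFun (Subtype.ext_iff.1 (gaugeBracket_gsmul_right f s t)) m
  anchor_bracket _ _ _ := rfl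

lemma isLieAlgebroid_gl : IsLieAlgebroid (E →L[ℝ] E) (glAlgebroid E M) :=
  isAlgebroidHom_gaugeEmbed.isLieAlgebroid_of_injective gaugeEmbed_injective isLieAlgebroid_gauge
    isSmoothVectorBundle_gl

lemma isLieAlgebroid_glOp : IsLieAlgebroid (E →L[ℝ] E) (glOpAlgebroid E M) :=
  isAlgebroidHom_neg.isLieAlgebroid_of_injective (fun _ => neg_injective) isLieAlgebroid_gl
    isSmoothVectorBundle_gl

lemma isAlgebroidHom_gaugeAnchor :
    IsAlgebroidHom (gaugeAlgebroid E M) (tangentAlgebroid E M) gaugeAnchor :=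
  isLieAlgebroid_gauge.isAlgebroidHom_anchor

lemma isAlgebroidIso_jetEquivGauge :
    IsAlgebroidIso (jetAlgebroid E M) (gaugeAlgebroid E M) jetEquivGauge := by
  have hhom : IsAlgebroidHom (jetAlgebroid E M) (gaugeAlgebroid E M)
      (fun m => (jetEquivGauge m).toLinearMap) :=
    { map_sections := fun μ => (mem_jetSections_iff μ).1
      map_anchor := fun _ _ => rfl
      map_bracket := fun μ ν => congrFun (Subtype.ext_iff.1 (jetPi_jetBracket μ ν)) }
  refine hhom.isAlgebroidIso fun d (hd : d ∈ gaugeSections) => (mem_jetSections_iff _).2 ?_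
  simpa only [LinearEquiv.apply_symm_apply] using hd

lemma isLieAlgebroid_jet : IsLieAlgebroid (E × (E →L[ℝ] E)) (jetAlgebroid E M) :=
  isAlgebroidIso_jetEquivGauge.1.isLieAlgebroid_of_injective jetToGauge_injective
    isLieAlgebroid_gauge (((gaugeFrames E M).congr jetEquivGauge
      mem_jetSections_iff).isSmoothVectorBundle (gaugeModelBasis E))

lemma isAlgebroidHom_jetProj :
    IsAlgebroidHom (jetAlgebroid E M) (tangentAlgebroid E M) jetProj := by
  have hanchor : (jetAlgebroid E M).anchor = jetProj :=
    funext fun m => LinearMap.ext (gaugeAnchor_jetToGauge m)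
  exact hanchor ▸ isLieAlgebroid_jet.isAlgebroidHom_anchor

lemma isAlgebroidHom_jetEmbed :
    IsAlgebroidHom (glOpAlgebroid E M) (jetAlgebroid E M) jetEmbed := by
  have hcomp (m : M) : (jetEquivGauge (E := E) m).symm.toLinearMap.comp
      ((gaugeEmbed m).comp (-LinearMap.id)) = jetEmbed m :=
    LinearMap.ext fun y => (jetEquivGauge m).symm_apply_eq.2 (jetToGauge_jetEmbed m y).symm
  exact funext hcomp ▸
    isAlgebroidIso_jetEquivGauge.2.comp (isAlgebroidHom_gaugeEmbed.comp isAlgebroidHom_neg)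

end Algebroids

end JetGauge

end

theorem mainTheorem7
    {E : Type*} [NormedAddCommGroup E] [NormedSpace ℝ E] [FiniteDimensional ℝ E]
    {M : Type*} [TopologicalSpace M] [T2Space M] [ChartedSpace E M] [IsManifold 𝓘(ℝ, E) ∞ M] :
    -- the Lie algebroids involved
    JetGauge.IsLieAlgebroid E (JetGauge.tangentAlgebroid E M) ∧
    JetGauge.IsLieAlgebroid (E →L[ℝ] E) (JetGauge.glAlgebroid E M) ∧
    JetGauge.IsLieAlgebroid (E →L[ℝ] E) (JetGauge.glOpAlgebroid E M) ∧
    JetGauge.IsLieAlgebroid (E × (E →L[ℝ] E)) (JetGauge.gaugeAlgebroid E M) ∧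
    JetGauge.IsLieAlgebroid (E × (E →L[ℝ] E)) (JetGauge.jetAlgebroid E M) ∧
    -- the jet sequence
    JetGauge.IsAlgebroidHom (JetGauge.glOpAlgebroid E M) (JetGauge.jetAlgebroid E M)
      JetGauge.jetEmbed ∧
    JetGauge.IsAlgebroidHom (JetGauge.jetAlgebroid E M) (JetGauge.tangentAlgebroid E M)
      JetGauge.jetProj ∧
    JetGauge.IsShortExact (JetGauge.jetEmbed (E := E) (M := M)) JetGauge.jetProj ∧
    -- the Atiyah sequence
    JetGauge.IsAlgebroidHom (JetGauge.glAlgebroid E M) (JetGauge.gaugeAlgebroid E M)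
      JetGauge.gaugeEmbed ∧
    JetGauge.IsAlgebroidHom (JetGauge.gaugeAlgebroid E M) (JetGauge.tangentAlgebroid E M)
      JetGauge.gaugeAnchor ∧
    JetGauge.IsShortExact (JetGauge.gaugeEmbed (E := E) (M := M)) JetGauge.gaugeAnchor ∧
    -- the canonical isomorphism and the commutative diagram
    ∃ Φ : ∀ m : M, JetGauge.Jet E m ≃ₗ[ℝ] JetGauge.Gauge E m,
      (∀ (m : M) (u : JetGauge.VField E M),
        (∀ v : JetGauge.VField E M, JetGauge.gaugeOp m (Φ m (JetGauge.jet m u)) v =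
          VectorField.mlieBracket 𝓘(ℝ, E) u v m) ∧
        JetGauge.gaugeAnchor m (Φ m (JetGauge.jet m u)) = u m) ∧
      JetGauge.IsAlgebroidIso (JetGauge.jetAlgebroid E M) (JetGauge.gaugeAlgebroid E M) Φ ∧
      (∀ (m : M) (y : JetGauge.Tang E m →L[ℝ] JetGauge.Tang E m),
        Φ m (JetGauge.jetEmbed m y) = JetGauge.gaugeEmbed m (-y)) ∧
      (∀ (m : M) (μ : JetGauge.Jet E m),
        JetGauge.gaugeAnchor m (Φ m μ) = JetGauge.jetProj m μ) :=
  ⟨JetGauge.isLieAlgebroid_tangent, JetGauge.isLieAlgebroid_gl, JetGauge.isLieAlgebroid_glOp,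
    JetGauge.isLieAlgebroid_gauge, JetGauge.isLieAlgebroid_jet,
    JetGauge.isAlgebroidHom_jetEmbed, JetGauge.isAlgebroidHom_jetProj, JetGauge.isShortExact_jet,
    JetGauge.isAlgebroidHom_gaugeEmbed, JetGauge.isAlgebroidHom_gaugeAnchor,
    JetGauge.isShortExact_gauge,
    JetGauge.jetEquivGauge, fun _ _ => ⟨fun _ => rfl, rfl⟩,
    JetGauge.isAlgebroidIso_jetEquivGauge, JetGauge.jetToGauge_jetEmbed,
    JetGauge.gaugeAnchor_jetToGauge⟩
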